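/- Write $[u,v]$ for the determinant of the matrix with columns $u,v\in\mathbb R^2$. Let $C:[0,1]\to\mathbb R^2$ be a $C^\infty$ curve with parameter $p$ which is non-degenerate, i.e. $[C_p,C_{p^2}]\neq 0$ on $[0,1]$, and has no fully affine inflection point, i.e. $$F=\frac{3[C_p,C_{p^2}][C_p,C_{p^4}]-5[C_p,C_{p^3}]^2+12[C_p,C_{p^2}][C_{p^2},C_{p^3}]}{[C_p,C_{p^2}]^2}$$ is nowhere zero on $[0,1]$ (subscripts denote derivatives, $C_{p^k}=d^kC/dp^k$). Put $\epsilon=\operatorname{sgn}F$ and $g=\sqrt{\epsilon F}$, let $\xi$ be the fully affine arc length, $d\xi=g\,dp$, so that $\partial_\xi=g^{-1}\partial_p$, let $l(C)=\int_0^1 g\,dp$ be the fully affine length, and let $$\varphi=-\frac{[C_\xi,C_{\xi^3}]}{[C_\xi,C_{\xi^2}]}$$ be the fully affine curvature. Call $C$ *extremal* for the fully affine length functional if the derivative at $t=0$ (from the right) of $t\mapsto l(C(\cdot,t))$ exists and equals $0$ for every smooth deformation $C(p,t)$, $0\le p\le 1$, $0\le t<T$ ($T>0$), of $C(\cdot,0)=C$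 through non-degenerate curves without fully affine inflection points such that $C_t=WC_\xi+UC_{\xi^2}$ with smooth functions $W,U$ of $(p,t)$ satisfying $W=U=U_p=U_{p^2}=U_{p^3}=0$ at $p=0$ and $p=1$ for all $t$ (here, for each $t$, $C_\xi$ and $C_{\xi^2}$ are taken with respect to the fully affine arc length of $C(\cdot,t)$). **Theorem.** $C$ is extremal for the fully affine length functional if and only if $$\varphi_{\xi^3}+\varphi\,\varphi_{\xi^2}+\frac{2\varphi^2+3\varphi_\xi+\epsilon}{9}\,\varphi_\xi=0$$ holds along $C$. In particular, if the fully affine curvature $\varphi$ of $C$ is constant, then $C$ is extremal. -/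

import Mathlib

open Set
open scoped ContDiff

noncomputable section

namespace FullyAffine

/-- The `k`-th derivative of a curve `C : [0,1] → ℝ²` with respect to its parameter `p`
(one-sided at the two end points). -/
def pDeriv (k : ℕ) (C : ℝ → Fin 2 → ℝ) (p : ℝ) : Fin 2 → ℝ :=
  iteratedDerivWithin k C (Icc 0 1) p

/-- The determinant `[u, v]` of the matrix with columns `u` and `v`. -/
def bracket (u v : Fin 2 → ℝ) : ℝ := u 0 * v 1 - u 1 * v 0

/-- The function `F = (3[C_p,C_pp][C_p,C_pppp] - 5[C_p,C_ppp]² + 12[C_p,C_pp][C_pp,C_ppp]) /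
[C_p,C_pp]²`. -/
def F (C : ℝ → Fin 2 → ℝ) (p : ℝ) : ℝ :=
  (3 * bracket (pDeriv 1 C p) (pDeriv 2 C p) * bracket (pDeriv 1 C p) (pDeriv 4 C p)
    - 5 * bracket (pDeriv 1 C p) (pDeriv 3 C p) ^ 2
    + 12 * bracket (pDeriv 1 C p) (pDeriv 2 C p) * bracket (pDeriv 2 C p) (pDeriv 3 C p))
  / bracket (pDeriv 1 C p) (pDeriv 2 C p) ^ 2

/-- The sign `ε` of `F`. -/
def ε (C : ℝ → Fin 2 → ℝ) (p : ℝ) : ℝ := Real.sign (F C p)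

/-- The density `g` of the fully affine arc length: `dξ = g dp` with `g = √(ε F)`. -/
def g (C : ℝ → Fin 2 → ℝ) (p : ℝ) : ℝ := Real.sqrt (ε C p * F C p)

/-- The fully affine length of `C : [0,1] → ℝ²`. -/
def length (C : ℝ → Fin 2 → ℝ) : ℝ := ∫ p in (0 : ℝ)..1, g C p

/-- Differentiation `∂/∂ξ = g⁻¹ ∂/∂p` along `C` with respect to fully affine arc length. -/
def ξDeriv {V : Type*} [NormedAddCommGroup V] [NormedSpace ℝ V]
    (C : ℝ → Fin 2 → ℝ) (f : ℝ → V) (p : ℝ) : V :=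
  (g C p)⁻¹ • derivWithin f (Icc 0 1) p

/-- The iterated derivative `f_{ξ^k}` with respect to fully affine arc length along `C`. -/
def ξDerivIter {V : Type*} [NormedAddCommGroup V] [NormedSpace ℝ V]
    (k : ℕ) (C : ℝ → Fin 2 → ℝ) (f : ℝ → V) : ℝ → V :=
  (ξDeriv C)^[k] f

/-- The fully affine curvature `φ = -[C_ξ, C_ξξξ] / [C_ξ, C_ξξ]`. -/
def φ (C : ℝ → Fin 2 → ℝ) (p : ℝ) : ℝ :=
  -(bracket (ξDerivIter 1 C C p) (ξDerivIter 3 C C p))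
    / bracket (ξDerivIter 1 C C p) (ξDerivIter 2 C C p)

/-- Smooth curves `C : [0,1] → ℝ²` that are non-degenerate and have no fully affine
inflection point. -/
structure IsRegularCurve (C : ℝ → Fin 2 → ℝ) : Prop where
  smooth : ContDiffOn ℝ ∞ C (Icc 0 1)
  nondegenerate : ∀ p ∈ Icc (0 : ℝ) 1, bracket (pDeriv 1 C p) (pDeriv 2 C p) ≠ 0
  noInflection : ∀ p ∈ Icc (0 : ℝ) 1, F C p ≠ 0

/-- `Γ(p,t)`, `0 ≤ p ≤ 1`, `0 ≤ t < T`, is a smooth deformation of `C` through regular curves,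
and `Γ_t = W Γ_ξ + U Γ_ξξ` with smooth `W`, `U` such that
`W`, `U`, `U_p`, `U_pp`, `U_ppp` vanish at the end points of the curve. -/
structure IsDeformation (C : ℝ → Fin 2 → ℝ) (T : ℝ) (Γ : ℝ → ℝ → Fin 2 → ℝ)
    (W U : ℝ → ℝ → ℝ) : Prop where
  smooth : ContDiffOn ℝ ∞ (fun x : ℝ × ℝ => Γ x.1 x.2) (Icc 0 1 ×ˢ Ico 0 T)
  initial : ∀ p ∈ Icc (0 : ℝ) 1, Γ p 0 = C p
  regular : ∀ t ∈ Ico 0 T, IsRegularCurve (fun p => Γ p t)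
  smooth_W : ContDiffOn ℝ ∞ (fun x : ℝ × ℝ => W x.1 x.2) (Icc 0 1 ×ˢ Ico 0 T)
  smooth_U : ContDiffOn ℝ ∞ (fun x : ℝ × ℝ => U x.1 x.2) (Icc 0 1 ×ˢ Ico 0 T)
  evolution : ∀ p ∈ Icc (0 : ℝ) 1, ∀ t ∈ Ico 0 T,
    HasDerivWithinAt (fun s => Γ p s)
      (W p t • ξDerivIter 1 (fun q => Γ q t) (fun q => Γ q t) p
        + U p t • ξDerivIter 2 (fun q => Γ q t) (fun q => Γ q t) p) (Ico 0 T) t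
  boundary_W : ∀ t ∈ Ico 0 T, W 0 t = 0 ∧ W 1 t = 0
  boundary_U : ∀ t ∈ Ico 0 T, ∀ i ≤ 3,
    iteratedDerivWithin i (fun p => U p t) (Icc 0 1) 0 = 0 ∧
    iteratedDerivWithin i (fun p => U p t) (Icc 0 1) 1 = 0

/-- `C` is extremal for the fully affine length: the first variation `l'(0)` of the length exists
and vanishes for every admissible deformation of `C`. -/
def IsExtremal (C : ℝ → Fin 2 → ℝ) : Prop :=
  ∀ (T : ℝ) (Γ : ℝ → ℝ → Fin 2 → ℝ) (W U : ℝ → ℝ → ℝ), 0 < T → IsDeformation C T Γ W U →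
    HasDerivWithinAt (fun t => length (fun p => Γ p t)) 0 (Ico 0 T) 0

end FullyAffine

end

/-! Differentiating the fully affine arc length of a moving curve directly would require commutators
of `∂_t` and `∂_ξ`. These are avoided by using the arc length of the initial curve `C` as a fixed
parameter throughout. `F` is a relative invariant of weight two under reparametrisation
(`affineForm_change`), so every smooth curve `Y` satisfies `F(Y) = g_C² · affineForm(Y_ξ, …,
Y_ξξξξ)` with `ξ` taken from `C` (`F_eq_sq_mul`), and this `∂_ξ` commutes with `∂_t`.

For `Y = C` the form equals `ε`, which determines the structure equation `C_ξξξ = a C_ξ - φ C_ξξ`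
with `a = -(ε + 3φ_ξ + 2φ²)/9` (`ξDerivIter_three`). Expanding the velocity `W C_ξ + U C_ξξ` in this
frame gives the derivative `d` of `affineForm` as a linear differential expression in `W` and `U`.
Integration by parts is packaged as a primitive: the `∂_ξ`-derivative of `boundaryTerm` is `d + U ·
eulerLagrange` (`hasDerivWithinAt_affineForm_field`). Since `2ε g_t = g d`, the endpoint conditions
leave `l'(0) = -(ε/2) ∫ g U · eulerLagrange dp` (`IsDeformation.hasDerivWithinAt_length`).

One implication is now immediate. For the other, every test function occurs as the initial `U` of an
admissible straight-line deformation (`exists_isDeformation`), and the fundamental lemma of the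
calculus of variations applies. -/

noncomputable section

namespace FullyAffine

/-! ### Determinants in the plane. -/

section Bracket

theorem bracket_add_left (u v w : Fin 2 → ℝ) : bracket (u + v) w = bracket u w + bracket v w := by
  simp only [bracket, Pi.add_apply]; ring

theorem bracket_add_right (u v w : Fin 2 → ℝ) : bracket u (v + w) = bracket u v + bracket u w := by
  simp only [bracket, Pi.add_apply]; ring

theorem bracket_smul_left (a : ℝ) (u v : Fin 2 → ℝ) : bracket (a • u) v = a * bracket u v := by
  simp only [bracket, Pi.smul_apply, smul_eq_mul]; ring

theorem bracket_smul_right (a : ℝ) (u v : Fin 2 → ℝ) : bracket u (a • v) = a * bracket u v := by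
  simp only [bracket, Pi.smul_apply, smul_eq_mul]; ring

theorem bracket_self (u : Fin 2 → ℝ) : bracket u u = 0 := by
  simp only [bracket]; ring

theorem bracket_swap (u v : Fin 2 → ℝ) : bracket u v = -bracket v u := by
  simp only [bracket]; ring

/-- Cramer's rule in the plane. -/
theorem eq_smul_add_smul_of_bracket_ne_zero {u v : Fin 2 → ℝ} (h : bracket u v ≠ 0)
    (x : Fin 2 → ℝ) :
    x = (bracket x v / bracket u v) • u + (bracket u x / bracket u v) • v := by
  ext i
  simp only [Pi.add_apply, Pi.smul_apply, smul_eq_mul]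
  rw [div_mul_eq_mul_div, div_mul_eq_mul_div, ← add_div, eq_div_iff h]
  fin_cases i <;> simp only [bracket, Fin.zero_eta, Fin.mk_one] <;> ring

theorem _root_.HasDerivWithinAt.bracket {u v : ℝ → Fin 2 → ℝ} {u' v' : Fin 2 → ℝ} {s : Set ℝ}
    {x : ℝ} (hu : HasDerivWithinAt u u' s x) (hv : HasDerivWithinAt v v' s x) :
    HasDerivWithinAt (fun y => FullyAffine.bracket (u y) (v y))
      (FullyAffine.bracket u' (v x) + FullyAffine.bracket (u x) v') s x := by
  rw [hasDerivWithinAt_pi] at hu hv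
  refine (((hu 0).mul (hv 1)).sub ((hu 1).mul (hv 0))).congr_deriv ?_
  simp only [FullyAffine.bracket]; ring

theorem _root_.ContDiffOn.bracket {E : Type*} [NormedAddCommGroup E] [NormedSpace ℝ E]
    {n : WithTop ℕ∞} {u v : E → Fin 2 → ℝ} {s : Set E}
    (hu : ContDiffOn ℝ n u s) (hv : ContDiffOn ℝ n v s) :
    ContDiffOn ℝ n (fun y => FullyAffine.bracket (u y) (v y)) s := by
  rw [contDiffOn_pi] at hu hv
  exact ((hu 0).mul (hv 1)).sub ((hu 1).mul (hv 0))

end Bracket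

/-! ### Smooth families on the strip and their partial derivatives. -/

section Partial

variable {V : Type*} [NormedAddCommGroup V] [NormedSpace ℝ V]

theorem uniqueDiffOn_Icc01 : UniqueDiffOn ℝ (Icc (0 : ℝ) 1) := uniqueDiffOn_Icc zero_lt_one

theorem uniqueDiffOn_Ico0 (T : ℝ) : UniqueDiffOn ℝ (Ico (0 : ℝ) T) := uniqueDiffOn_Ico 0 T

theorem uniqueDiffOn_strip (T : ℝ) : UniqueDiffOn ℝ (Icc (0 : ℝ) 1 ×ˢ Ico (0 : ℝ) T) :=
  uniqueDiffOn_Icc01.prod (uniqueDiffOn_Ico0 T)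

/-- Joint smoothness of a family on the strip `[0,1] × [0,T)`. -/
def SmoothFamily (T : ℝ) (f : ℝ → ℝ → V) : Prop :=
  ContDiffOn ℝ ∞ (fun x : ℝ × ℝ => f x.1 x.2) (Icc 0 1 ×ˢ Ico 0 T)

/-- The partial derivative along the curves. -/
def partialP (f : ℝ → ℝ → V) (p t : ℝ) : V := derivWithin (fun q => f q t) (Icc 0 1) p

/-- The partial derivative with respect to the deformation parameter. -/
def partialT (T : ℝ) (f : ℝ → ℝ → V) (p t : ℝ) : V := derivWithin (fun s => f p s) (Ico 0 T) t

variable {T : ℝ} {f : ℝ → ℝ → V}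

namespace SmoothFamily

theorem hasDerivWithinAt_fst_aux (hf : SmoothFamily T f) {p t : ℝ} (hp : p ∈ Icc (0 : ℝ) 1)
    (ht : t ∈ Ico 0 T) :
    HasDerivWithinAt (fun q => f q t)
      (fderivWithin ℝ (fun x : ℝ × ℝ => f x.1 x.2) (Icc 0 1 ×ˢ Ico 0 T) (p, t) (1, 0))
      (Icc 0 1) p := by
  have h1 := (hf.differentiableOn (by simp) (p, t) ⟨hp, ht⟩).hasFDerivWithinAt
  have h2 : HasDerivWithinAt (fun q : ℝ => (q, t)) ((1 : ℝ), (0 : ℝ)) (Icc 0 1) p :=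
    (hasDerivWithinAt_id p _).prodMk (hasDerivWithinAt_const p _ t)
  exact h1.comp_hasDerivWithinAt p h2 (fun q hq => mk_mem_prod hq ht)

theorem hasDerivWithinAt_snd_aux (hf : SmoothFamily T f) {p t : ℝ} (hp : p ∈ Icc (0 : ℝ) 1)
    (ht : t ∈ Ico 0 T) :
    HasDerivWithinAt (fun s => f p s)
      (fderivWithin ℝ (fun x : ℝ × ℝ => f x.1 x.2) (Icc 0 1 ×ˢ Ico 0 T) (p, t) (0, 1))
      (Ico 0 T) t := by
  have h1 := (hf.differentiableOn (by simp) (p, t) ⟨hp, ht⟩).hasFDerivWithinAt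
  have h2 : HasDerivWithinAt (fun s : ℝ => (p, s)) ((0 : ℝ), (1 : ℝ)) (Ico 0 T) t :=
    (hasDerivWithinAt_const t _ p).prodMk (hasDerivWithinAt_id t _)
  exact h1.comp_hasDerivWithinAt t h2 (fun q hq => ⟨hp, hq⟩)

theorem partialP_eq (hf : SmoothFamily T f) {p t : ℝ} (hp : p ∈ Icc (0 : ℝ) 1)
    (ht : t ∈ Ico 0 T) : partialP f p t =
      fderivWithin ℝ (fun x : ℝ × ℝ => f x.1 x.2) (Icc 0 1 ×ˢ Ico 0 T) (p, t) (1, 0) :=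
  (hf.hasDerivWithinAt_fst_aux hp ht).derivWithin (uniqueDiffOn_Icc01 p hp)

theorem partialT_eq (hf : SmoothFamily T f) {p t : ℝ} (hp : p ∈ Icc (0 : ℝ) 1)
    (ht : t ∈ Ico 0 T) : partialT T f p t =
      fderivWithin ℝ (fun x : ℝ × ℝ => f x.1 x.2) (Icc 0 1 ×ˢ Ico 0 T) (p, t) (0, 1) :=
  (hf.hasDerivWithinAt_snd_aux hp ht).derivWithin (uniqueDiffOn_Ico0 T t ht)

theorem hasDerivWithinAt_snd (hf : SmoothFamily T f) {p t : ℝ} (hp : p ∈ Icc (0 : ℝ) 1)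
    (ht : t ∈ Ico 0 T) : HasDerivWithinAt (fun s => f p s) (partialT T f p t) (Ico 0 T) t := by
  rw [hf.partialT_eq hp ht]; exact hf.hasDerivWithinAt_snd_aux hp ht

theorem fderivWithin_apply (hf : SmoothFamily T f) (v : ℝ × ℝ) :
    ContDiffOn ℝ ∞ (fun x : ℝ × ℝ =>
      fderivWithin ℝ (fun x : ℝ × ℝ => f x.1 x.2) (Icc 0 1 ×ˢ Ico 0 T) x v)
      (Icc 0 1 ×ˢ Ico 0 T) :=
  (ContDiffOn.fderivWithin hf (uniqueDiffOn_strip T) (by simp)).clm_apply contDiffOn_const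

protected theorem partialP (hf : SmoothFamily T f) : SmoothFamily T (partialP f) :=
  (hf.fderivWithin_apply (1, 0)).congr fun _ hx => hf.partialP_eq hx.1 hx.2

protected theorem partialT (hf : SmoothFamily T f) : SmoothFamily T (partialT T f) :=
  (hf.fderivWithin_apply (0, 1)).congr fun _ hx => hf.partialT_eq hx.1 hx.2

theorem congr {f' : ℝ → ℝ → V} (hf : SmoothFamily T f)
    (h : ∀ p ∈ Icc (0 : ℝ) 1, ∀ t ∈ Ico 0 T, f' p t = f p t) : SmoothFamily T f' :=
  ContDiffOn.congr hf fun _ hx => h _ hx.1 _ hx.2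

theorem slice (hf : SmoothFamily T f) {t : ℝ} (ht : t ∈ Ico 0 T) :
    ContDiffOn ℝ ∞ (fun p => f p t) (Icc 0 1) :=
  ContDiffOn.comp hf (contDiff_prodMk_left t).contDiffOn fun _ hp => ⟨hp, ht⟩

theorem of_slice {h : ℝ → V} (hh : ContDiffOn ℝ ∞ h (Icc 0 1)) :
    SmoothFamily T (fun p _ => h p) :=
  ContDiffOn.comp hh contDiff_fst.contDiffOn fun _ hx => hx.1

theorem smul {a : ℝ → ℝ → ℝ} (ha : SmoothFamily T a) (hf : SmoothFamily T f) :
    SmoothFamily T (fun p t => a p t • f p t) := ContDiffOn.smul ha hf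

/-- Symmetry of the second derivative within a set needs points that are limits of interior points;
this covers the edges of the strip, including `t = 0`. -/
theorem closure_interior_strip (hT : 0 < T) {x : ℝ × ℝ}
    (hx : x ∈ Icc (0 : ℝ) 1 ×ˢ Ico (0 : ℝ) T) :
    x ∈ closure (interior (Icc (0 : ℝ) 1 ×ˢ Ico (0 : ℝ) T)) := by
  rw [interior_prod_eq, closure_prod_eq, interior_Icc, interior_Ico, closure_Ioo zero_ne_one,
    closure_Ioo hT.ne]
  exact ⟨hx.1, Ico_subset_Icc_self hx.2⟩

theorem partialT_partialP (hf : SmoothFamily T f) {p t : ℝ} (hp : p ∈ Icc (0 : ℝ) 1)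
    (ht : t ∈ Ico 0 T) : partialT T (partialP f) p t = partialP (partialT T f) p t := by
  set G := fun x : ℝ × ℝ => f x.1 x.2 with hG
  set S := Icc (0 : ℝ) 1 ×ˢ Ico 0 T with hS
  have hx : (p, t) ∈ S := ⟨hp, ht⟩
  have hd : DifferentiableWithinAt ℝ (fderivWithin ℝ G S) S (p, t) :=
    (ContDiffOn.fderivWithin hf (uniqueDiffOn_strip T) (m := ∞) (by simp)).differentiableOn
      (by simp) _ hx
  have key : ∀ v : ℝ × ℝ, fderivWithin ℝ (fun x => fderivWithin ℝ G S x v) S (p, t) =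
      (fderivWithin ℝ (fderivWithin ℝ G S) S (p, t)).flip v := by
    intro v
    rw [fderivWithin_clm_apply (uniqueDiffOn_strip T _ hx) hd (differentiableWithinAt_const v)]
    ext <;> simp [hS]
  have e1 : partialT T (partialP f) p t =
      fderivWithin ℝ (fun x => fderivWithin ℝ G S x (1, 0)) S (p, t) (0, 1) := by
    rw [hf.partialP.partialT_eq hp ht]
    congr 1
    exact fderivWithin_congr (fun x hx => hf.partialP_eq hx.1 hx.2) (hf.partialP_eq hp ht)
  have e2 : partialP (partialT T f) p t =
      fderivWithin ℝ (fun x => fderivWithin ℝ G S x (0, 1)) S (p, t) (1, 0) := by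
    rw [hf.partialT.partialP_eq hp ht]
    congr 1
    exact fderivWithin_congr (fun x hx => hf.partialT_eq hx.1 hx.2) (hf.partialT_eq hp ht)
  have hsymm := ContDiffWithinAt.isSymmSndFDerivWithinAt (hf (p, t) hx)
    (by
      rw [minSmoothness_of_isRCLikeNormedField]
      exact WithTop.coe_le_coe.2 (le_top : (2 : ℕ∞) ≤ ⊤))
    (uniqueDiffOn_strip T)
    (closure_interior_strip (ht.1.trans_lt ht.2) hx) hx
  rw [e1, e2, key, key]
  exact hsymm _ _

end SmoothFamily

end Partial

/-! ### Dependence on the values over `[0,1]` only. -/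

section Congr

variable {V : Type*} [NormedAddCommGroup V] [NormedSpace ℝ V]
variable {C C' : ℝ → Fin 2 → ℝ} {f f' : ℝ → V}

theorem pDeriv_congr (h : EqOn C C' (Icc 0 1)) (k : ℕ) :
    EqOn (pDeriv k C) (pDeriv k C') (Icc 0 1) :=
  iteratedDerivWithin_congr h

theorem F_congr (h : EqOn C C' (Icc 0 1)) : EqOn (F C) (F C') (Icc 0 1) := fun p hp => by
  simp only [F, pDeriv_congr h _ hp]

theorem g_congr (h : EqOn C C' (Icc 0 1)) : EqOn (g C) (g C') (Icc 0 1) := fun p hp => by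
  simp only [g, ε, F_congr h hp]

theorem ξDeriv_congr (h : EqOn C C' (Icc 0 1)) (hf : EqOn f f' (Icc 0 1)) :
    EqOn (ξDeriv C f) (ξDeriv C' f') (Icc 0 1) := fun p hp => by
  simp only [ξDeriv, g_congr h hp, derivWithin_congr hf (hf hp)]

theorem ξDerivIter_zero : ξDerivIter 0 C f = f := rfl

theorem ξDerivIter_succ (k : ℕ) : ξDerivIter (k + 1) C f = ξDeriv C (ξDerivIter k C f) :=
  Function.iterate_succ_apply' _ _ _

theorem ξDerivIter_congr (h : EqOn C C' (Icc 0 1)) (hf : EqOn f f' (Icc 0 1)) (k : ℕ) :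
    EqOn (ξDerivIter k C f) (ξDerivIter k C' f') (Icc 0 1) := by
  induction k with
  | zero => exact hf
  | succ k ih => rw [ξDerivIter_succ, ξDerivIter_succ]; exact ξDeriv_congr h ih

theorem ξDerivIter_add (j k : ℕ) :
    ξDerivIter j C (ξDerivIter k C f) = ξDerivIter (j + k) C f :=
  (Function.iterate_add_apply _ _ _ _).symm

end Congr

/-- The fully affine density as a function of the first four derivatives of a curve. -/
def affineForm (c₁ c₂ c₃ c₄ : Fin 2 → ℝ) : ℝ :=
  (3 * bracket c₁ c₂ * bracket c₁ c₄ - 5 * bracket c₁ c₃ ^ 2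
    + 12 * bracket c₁ c₂ * bracket c₂ c₃) / bracket c₁ c₂ ^ 2

theorem F_eq_affineForm (C : ℝ → Fin 2 → ℝ) (p : ℝ) :
    F C p = affineForm (pDeriv 1 C p) (pDeriv 2 C p) (pDeriv 3 C p) (pDeriv 4 C p) := rfl

protected theorem SmoothFamily.pDeriv {T : ℝ} {Γ : ℝ → ℝ → Fin 2 → ℝ} (hΓ : SmoothFamily T Γ) (k : ℕ) :
    SmoothFamily T (fun p t => pDeriv k (fun q => Γ q t) p) := by
  induction k with
  | zero => exact hΓ.congr fun p _ t _ => by simp [FullyAffine.pDeriv]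
  | succ k ih => exact ih.partialP.congr fun p _ t _ => congrFun iteratedDerivWithin_succ p

/-- A smooth family of regular curves. -/
structure IsRegularFamily (T : ℝ) (Γ : ℝ → ℝ → Fin 2 → ℝ) : Prop where
  smooth : SmoothFamily T Γ
  regular : ∀ t ∈ Ico 0 T, IsRegularCurve (fun p => Γ p t)

theorem IsDeformation.isRegularFamily {C : ℝ → Fin 2 → ℝ} {T : ℝ} {Γ : ℝ → ℝ → Fin 2 → ℝ}
    {W U : ℝ → ℝ → ℝ} (h : IsDeformation C T Γ W U) : IsRegularFamily T Γ :=
  ⟨h.smooth, h.regular⟩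

/-- The constant family lets smoothness and sign facts for one curve be read off from those for
families. -/
theorem IsRegularCurve.isRegularFamily {C : ℝ → Fin 2 → ℝ} (hC : IsRegularCurve C) (T : ℝ) :
    IsRegularFamily T (fun p _ => C p) :=
  ⟨SmoothFamily.of_slice hC.smooth, fun _ _ => hC⟩

/-! ### Sign, density and arc-length derivatives in a regular family. -/

namespace IsRegularFamily

variable {T : ℝ} {Γ : ℝ → ℝ → Fin 2 → ℝ}

theorem smooth_F (h : IsRegularFamily T Γ) :
    SmoothFamily T (fun p t => F (fun q => Γ q t) p) := by
  have b : ∀ i j, ContDiffOn ℝ ∞ (fun x : ℝ × ℝ =>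
      bracket (pDeriv i (fun q => Γ q x.2) x.1) (pDeriv j (fun q => Γ q x.2) x.1))
      (Icc 0 1 ×ˢ Ico 0 T) :=
    fun i j => ContDiffOn.bracket (h.smooth.pDeriv i) (h.smooth.pDeriv j)
  refine ContDiffOn.div ?_ ((b 1 2).pow 2)
    fun x hx => pow_ne_zero 2 ((h.regular x.2 hx.2).nondegenerate x.1 hx.1)
  exact (((contDiffOn_const.mul (b 1 2)).mul (b 1 4)).sub
    (contDiffOn_const.mul ((b 1 3).pow 2))).add ((contDiffOn_const.mul (b 1 2)).mul (b 2 3))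

/-- The sign `ε` is constant along a family of regular curves. -/
theorem exists_sign (h : IsRegularFamily T Γ) :
    ∃ e : ℝ, e ^ 2 = 1 ∧ ∀ p ∈ Icc (0 : ℝ) 1, ∀ t ∈ Ico 0 T,
      ε (fun q => Γ q t) p = e ∧ 0 < e * F (fun q => Γ q t) p := by
  have hc := h.smooth_F.continuousOn
  have hne : ∀ x ∈ Icc (0 : ℝ) 1 ×ˢ Ico 0 T, F (fun q => Γ q x.2) x.1 ≠ 0 :=
    fun x hx => (h.regular x.2 hx.2).noInflection x.1 hx.1
  have hconn : IsPreconnected (Icc (0 : ℝ) 1 ×ˢ Ico 0 T) :=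
    isPreconnected_Icc.prod isPreconnected_Ico
  by_cases hpos : ∀ x ∈ Icc (0 : ℝ) 1 ×ˢ Ico 0 T, 0 < F (fun q => Γ q x.2) x.1
  · refine ⟨1, by norm_num, fun p hp t ht => ?_⟩
    have := hpos (p, t) ⟨hp, ht⟩
    exact ⟨Real.sign_of_pos this, by simpa using this⟩
  · push Not at hpos
    obtain ⟨x, hx, hx'⟩ := hpos
    refine ⟨-1, by norm_num, fun p hp t ht => ?_⟩
    -- The strip is connected and `F` has no zero on it, so one negative value forces all values to
    -- be negative.
    have hneg : F (fun q => Γ q t) p < 0 := by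
      by_contra! hcon
      obtain ⟨y, hy, hy0⟩ := hconn.intermediate_value hx (mk_mem_prod hp ht) hc
        (show (0 : ℝ) ∈ Icc _ _ from ⟨hx', hcon⟩)
      exact hne y hy hy0
    exact ⟨Real.sign_of_neg hneg, by linarith⟩

theorem smooth_g (h : IsRegularFamily T Γ) :
    SmoothFamily T (fun p t => g (fun q => Γ q t) p) := by
  obtain ⟨e, -, he⟩ := h.exists_sign
  have h1 : SmoothFamily T (fun p t => Real.sqrt (e * F (fun q => Γ q t) p)) :=
    ContDiffOn.sqrt (contDiffOn_const.mul h.smooth_F) fun x hx => (he _ hx.1 _ hx.2).2.ne'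
  exact h1.congr fun p hp t ht => by simp only [g, (he p hp t ht).1]

theorem g_pos (h : IsRegularFamily T Γ) {p t : ℝ} (hp : p ∈ Icc (0 : ℝ) 1) (ht : t ∈ Ico 0 T) :
    0 < g (fun q => Γ q t) p := by
  obtain ⟨e, -, he⟩ := h.exists_sign
  rw [g, (he p hp t ht).1]
  exact Real.sqrt_pos.2 (he p hp t ht).2

variable {V : Type*} [NormedAddCommGroup V] [NormedSpace ℝ V]

theorem smooth_ξDerivIter (h : IsRegularFamily T Γ) {f : ℝ → ℝ → V} (hf : SmoothFamily T f)
    (k : ℕ) : SmoothFamily T (fun p t => ξDerivIter k (fun q => Γ q t) (fun q => f q t) p) := by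
  induction k with
  | zero => exact hf
  | succ k ih =>
    have hinv : SmoothFamily T (fun p t => (g (fun q => Γ q t) p)⁻¹) :=
      ContDiffOn.inv h.smooth_g fun x hx => (h.g_pos hx.1 hx.2).ne'
    exact (hinv.smul ih.partialP).congr fun p _ t _ => by rw [ξDerivIter_succ]; rfl

end IsRegularFamily

/-! ### Arc-length calculus along a fixed curve. -/

namespace IsRegularCurve

variable {C : ℝ → Fin 2 → ℝ} {V : Type*} [NormedAddCommGroup V] [NormedSpace ℝ V]

theorem g_pos (hC : IsRegularCurve C) {p : ℝ} (hp : p ∈ Icc (0 : ℝ) 1) : 0 < g C p :=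
  (hC.isRegularFamily 1).g_pos hp (left_mem_Ico.2 one_pos)

theorem smooth_g (hC : IsRegularCurve C) : ContDiffOn ℝ ∞ (g C) (Icc 0 1) :=
  (hC.isRegularFamily 1).smooth_g.slice (left_mem_Ico.2 one_pos)

theorem smooth_ξDerivIter (hC : IsRegularCurve C) {f : ℝ → V}
    (hf : ContDiffOn ℝ ∞ f (Icc 0 1)) (k : ℕ) :
    ContDiffOn ℝ ∞ (ξDerivIter k C f) (Icc 0 1) :=
  ((hC.isRegularFamily 1).smooth_ξDerivIter (.of_slice hf) k).slice (left_mem_Ico.2 one_pos)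

theorem exists_sign (hC : IsRegularCurve C) :
    ∃ e : ℝ, e ^ 2 = 1 ∧ ∀ p ∈ Icc (0 : ℝ) 1, ε C p = e ∧ 0 < e * F C p := by
  obtain ⟨e, he, h⟩ := (hC.isRegularFamily 1).exists_sign
  exact ⟨e, he, fun p hp => h p hp 0 (left_mem_Ico.2 one_pos)⟩

theorem hasDerivWithinAt (hC : IsRegularCurve C) {f : ℝ → V}
    (hf : ContDiffOn ℝ ∞ f (Icc 0 1)) {p : ℝ} (hp : p ∈ Icc (0 : ℝ) 1) :
    HasDerivWithinAt f (g C p • ξDeriv C f p) (Icc 0 1) p := by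
  rw [ξDeriv, smul_inv_smul₀ (hC.g_pos hp).ne']
  exact (hf.differentiableOn (by simp) p hp).hasDerivWithinAt

theorem hasDerivWithinAt_ξDerivIter (hC : IsRegularCurve C) {f : ℝ → V}
    (hf : ContDiffOn ℝ ∞ f (Icc 0 1)) (k : ℕ) {p : ℝ} (hp : p ∈ Icc (0 : ℝ) 1) :
    HasDerivWithinAt (ξDerivIter k C f) (g C p • ξDerivIter (k + 1) C f p) (Icc 0 1) p := by
  rw [ξDerivIter_succ]
  exact hC.hasDerivWithinAt (hC.smooth_ξDerivIter hf k) hp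

theorem ξDeriv_eq (hC : IsRegularCurve C) {f f₁ : ℝ → V} {p : ℝ} (hp : p ∈ Icc (0 : ℝ) 1)
    (h : HasDerivWithinAt f (g C p • f₁ p) (Icc 0 1) p) : ξDeriv C f p = f₁ p := by
  rw [ξDeriv, h.derivWithin (uniqueDiffOn_Icc01 p hp), inv_smul_smul₀ (hC.g_pos hp).ne']

/-- Fully affine differentiation along a fixed curve commutes with the deformation parameter. -/
theorem partialT_ξDerivIter (hC : IsRegularCurve C) {T : ℝ} {f : ℝ → ℝ → V}
    (hf : SmoothFamily T f) (k : ℕ) {p t : ℝ} (hp : p ∈ Icc (0 : ℝ) 1) (ht : t ∈ Ico 0 T) :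
    HasDerivWithinAt (fun s => ξDerivIter k C (fun q => f q s) p)
      (ξDerivIter k C (fun q => partialT T f q t) p) (Ico 0 T) t := by
  induction k generalizing p t with
  | zero => exact hf.hasDerivWithinAt_snd hp ht
  | succ k ih =>
    simp only [ξDerivIter_succ]
    have hs := (hC.isRegularFamily T).smooth_ξDerivIter hf k
    refine ((hs.partialP.hasDerivWithinAt_snd hp ht).const_smul (g C p)⁻¹).congr_deriv ?_
    rw [hs.partialT_partialP hp ht, ξDeriv]
    congr 1
    have : ∀ q ∈ Icc (0 : ℝ) 1, partialT T (fun p t => ξDerivIter k C (fun q => f q t) p) q t =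
        ξDerivIter k C (fun q => partialT T f q t) q :=
      fun q hq => (ih hq ht).derivWithin (uniqueDiffOn_Ico0 T t ht)
    exact derivWithin_congr this (this p hp)

end IsRegularCurve

/-- Differentiation under the integral sign along a smooth family. -/
theorem SmoothFamily.hasDerivWithinAt_integral {T : ℝ} (hT : 0 < T) {f : ℝ → ℝ → ℝ}
    (hf : SmoothFamily T f) :
    HasDerivWithinAt (fun t => ∫ p in (0 : ℝ)..1, f p t) (∫ p in (0 : ℝ)..1, partialT T f p 0)
      (Ico 0 T) 0 := by
  have h0 : (0 : ℝ) ∈ Ico 0 T := left_mem_Ico.2 hT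
  -- The strip is not compact; halving `T` gives a compact rectangle on which `∂_t f` is bounded.
  have hsub : Icc (0 : ℝ) 1 ×ˢ Icc 0 (T / 2) ⊆ Icc (0 : ℝ) 1 ×ˢ Ico 0 T :=
    prod_mono le_rfl fun t ht => ⟨ht.1, by linarith [ht.2]⟩
  obtain ⟨M, hM⟩ := (isCompact_Icc.prod isCompact_Icc).exists_bound_of_continuousOn
    (hf.partialT.continuousOn.mono hsub)
  have hint : ∀ t ∈ Ico 0 T, IntervalIntegrable (fun p => f p t) MeasureTheory.volume 0 1 :=
    fun t ht => ContinuousOn.intervalIntegrable (by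
      rw [uIcc_of_le zero_le_one]; exact (hf.slice ht).continuousOn)
  rw [hasDerivWithinAt_iff_tendsto_slope]
  have hev : ∀ᶠ t in nhdsWithin 0 (Ico 0 T \ {0}), t ∈ Ioc 0 (T / 2) := by
    have h1 : Iio (T / 2) ∈ nhdsWithin 0 (Ico 0 T \ {0}) :=
      mem_nhdsWithin_of_mem_nhds (Iio_mem_nhds (by linarith))
    filter_upwards [h1, self_mem_nhdsWithin] with t h1 h2
    exact ⟨lt_of_le_of_ne h2.1.1 (Ne.symm h2.2), le_of_lt h1⟩
  have hslope : (fun t => ∫ p in (0 : ℝ)..1, slope (f p) 0 t) =ᶠ[nhdsWithin 0 (Ico 0 T \ {0})]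
      slope (fun t => ∫ p in (0 : ℝ)..1, f p t) 0 := by
    filter_upwards [hev] with t ht
    have ht' : t ∈ Ico 0 T := ⟨ht.1.le, by linarith [ht.2]⟩
    simp only [slope_def_field]
    rw [intervalIntegral.integral_div, intervalIntegral.integral_sub (hint t ht') (hint 0 h0)]
  refine Filter.Tendsto.congr' hslope ?_
  refine intervalIntegral.tendsto_integral_filter_of_dominated_convergence (fun _ => M) ?_ ?_ ?_ ?_
  · filter_upwards [hev] with t ht
    have ht' : t ∈ Ico 0 T := ⟨ht.1.le, by linarith [ht.2]⟩
    simp only [slope_def_field]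
    exact (((hint t ht').sub (hint 0 h0)).div_const _).def'.aestronglyMeasurable
  · filter_upwards [hev] with t ht
    refine Filter.Eventually.of_forall fun p hp => ?_
    rw [uIoc_of_le zero_le_one] at hp
    have hp' := Ioc_subset_Icc_self hp
    -- By the mean value inequality the difference quotients are dominated by the constant `M`.
    have hle := Convex.norm_image_sub_le_of_norm_hasDerivWithin_le
      (f := f p) (f' := partialT T f p) (s := Icc 0 (T / 2)) (x := 0) (y := t) (C := M)
      (fun x hx => (hf.hasDerivWithinAt_snd hp' (hsub (mk_mem_prod hp' hx)).2).mono
        fun y hy => (hsub (mk_mem_prod hp' hy)).2)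
      (fun x hx => hM (p, x) ⟨hp', hx⟩) (convex_Icc _ _)
      ⟨le_rfl, by linarith⟩ ⟨ht.1.le, ht.2⟩
    rw [slope_def_field, norm_div, div_le_iff₀ (norm_pos_iff.2 (by simpa using ht.1.ne'))]
    exact hle
  · exact intervalIntegrable_const
  · refine Filter.Eventually.of_forall fun p hp => ?_
    rw [uIoc_of_le zero_le_one] at hp
    exact hasDerivWithinAt_iff_tendsto_slope.1
      (hf.hasDerivWithinAt_snd (Ioc_subset_Icc_self hp) h0)

/-- The arguments on the left are the chain-rule expansions for `∂_p = g ∂_ξ`, with `a, b, c, d`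
standing for `g, g_ξ, g_ξξ, g_ξξξ`. The coefficients 3, -5, 12 make every term in `b`, `c`, `d`
cancel; the numerator then scales by `a ^ 8` and the denominator by `a ^ 6`. -/
theorem affineForm_change (a b c d : ℝ) (ha : a ≠ 0) (y₁ y₂ y₃ y₄ : Fin 2 → ℝ) :
    affineForm (a • y₁) ((a * b) • y₁ + a ^ 2 • y₂)
      ((a * b ^ 2 + a ^ 2 * c) • y₁ + (3 * a ^ 2 * b) • y₂ + a ^ 3 • y₃)
      ((a * b ^ 3 + 4 * a ^ 2 * b * c + a ^ 3 * d) • y₁ + (7 * a ^ 2 * b ^ 2 + 4 * a ^ 3 * c) • y₂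
        + (6 * a ^ 3 * b) • y₃ + a ^ 4 • y₄) = a ^ 2 * affineForm y₁ y₂ y₃ y₄ := by
  have h6 : a ^ 6 ≠ 0 := pow_ne_zero 6 ha
  rw [affineForm, affineForm, ← mul_div_assoc, ← mul_div_mul_left (a ^ 2 * _) _ h6]
  simp only [bracket, Pi.add_apply, Pi.smul_apply, smul_eq_mul]
  congr 1 <;> ring

/-! ### From the parameter to the arc length of a reference curve. -/

namespace IsRegularCurve

variable {C : ℝ → Fin 2 → ℝ} {V : Type*} [NormedAddCommGroup V] [NormedSpace ℝ V]

section Change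

variable {f : ℝ → V}

/-- This and the next three expansions form a triangular system with powers of `g` on the diagonal.
It feeds `affineForm_change` and is inverted at the endpoints to transfer the boundary conditions on
`U`. -/
theorem iteratedDerivWithin_one_ξDerivIter (hC : IsRegularCurve C) (hf : ContDiffOn ℝ ∞ f (Icc 0 1)) {p : ℝ}
    (hp : p ∈ Icc (0 : ℝ) 1) : iteratedDerivWithin 1 f (Icc 0 1) p =
      g C p • ξDerivIter 1 C f p := by
  rw [iteratedDerivWithin_one]
  exact (hC.hasDerivWithinAt_ξDerivIter hf 0 hp).derivWithin (uniqueDiffOn_Icc01 p hp)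

theorem iteratedDerivWithin_two_ξDerivIter (hC : IsRegularCurve C)
    (hf : ContDiffOn ℝ ∞ f (Icc 0 1)) {p : ℝ} (hp : p ∈ Icc (0 : ℝ) 1) :
    iteratedDerivWithin 2 f (Icc 0 1) p =
      (g C p * ξDerivIter 1 C (g C) p) • ξDerivIter 1 C f p
        + g C p ^ 2 • ξDerivIter 2 C f p := by
  have hg := hC.hasDerivWithinAt_ξDerivIter hC.smooth_g 0 hp
  have h := hg.smul (hC.hasDerivWithinAt_ξDerivIter hf 1 hp)
  rw [iteratedDerivWithin_succ]
  have e : EqOn (iteratedDerivWithin 1 f (Icc 0 1)) (fun q => g C q • ξDerivIter 1 C f q)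
      (Icc 0 1) := fun q hq => hC.iteratedDerivWithin_one_ξDerivIter hf hq
  rw [derivWithin_congr e (e hp)]
  refine (h.derivWithin (uniqueDiffOn_Icc01 p hp)).trans ?_
  simp only [ξDerivIter_zero, smul_eq_mul]
  module

theorem iteratedDerivWithin_three_ξDerivIter (hC : IsRegularCurve C)
    (hf : ContDiffOn ℝ ∞ f (Icc 0 1)) {p : ℝ} (hp : p ∈ Icc (0 : ℝ) 1) :
    iteratedDerivWithin 3 f (Icc 0 1) p =
      (g C p * ξDerivIter 1 C (g C) p ^ 2 + g C p ^ 2 * ξDerivIter 2 C (g C) p)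
          • ξDerivIter 1 C f p
        + (3 * g C p ^ 2 * ξDerivIter 1 C (g C) p) • ξDerivIter 2 C f p
        + g C p ^ 3 • ξDerivIter 3 C f p := by
  have hg := hC.hasDerivWithinAt_ξDerivIter hC.smooth_g 0 hp
  have hg1 := hC.hasDerivWithinAt_ξDerivIter hC.smooth_g 1 hp
  have h := ((hg.mul hg1).smul (hC.hasDerivWithinAt_ξDerivIter hf 1 hp)).add
    ((hg.pow 2).smul (hC.hasDerivWithinAt_ξDerivIter hf 2 hp))
  rw [iteratedDerivWithin_succ]
  have e : EqOn (iteratedDerivWithin 2 f (Icc 0 1)) _ (Icc 0 1) :=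
    fun q hq => hC.iteratedDerivWithin_two_ξDerivIter hf hq
  rw [derivWithin_congr e (e hp)]
  refine (h.derivWithin (uniqueDiffOn_Icc01 p hp)).trans ?_
  simp only [ξDerivIter_zero, smul_eq_mul, Pi.mul_apply, Pi.pow_apply]
  module

theorem iteratedDerivWithin_four_ξDerivIter (hC : IsRegularCurve C)
    (hf : ContDiffOn ℝ ∞ f (Icc 0 1)) {p : ℝ} (hp : p ∈ Icc (0 : ℝ) 1) :
    iteratedDerivWithin 4 f (Icc 0 1) p =
      (g C p * ξDerivIter 1 C (g C) p ^ 3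
          + 4 * g C p ^ 2 * ξDerivIter 1 C (g C) p * ξDerivIter 2 C (g C) p
          + g C p ^ 3 * ξDerivIter 3 C (g C) p) • ξDerivIter 1 C f p
        + (7 * g C p ^ 2 * ξDerivIter 1 C (g C) p ^ 2 + 4 * g C p ^ 3 * ξDerivIter 2 C (g C) p)
          • ξDerivIter 2 C f p
        + (6 * g C p ^ 3 * ξDerivIter 1 C (g C) p) • ξDerivIter 3 C f p
        + g C p ^ 4 • ξDerivIter 4 C f p := by
  have hg := hC.hasDerivWithinAt_ξDerivIter hC.smooth_g 0 hp
  have hg1 := hC.hasDerivWithinAt_ξDerivIter hC.smooth_g 1 hp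
  have hg2 := hC.hasDerivWithinAt_ξDerivIter hC.smooth_g 2 hp
  have h := ((((hg.mul (hg1.pow 2)).add ((hg.pow 2).mul hg2)).smul
      (hC.hasDerivWithinAt_ξDerivIter hf 1 hp)).add
    ((((hg.pow 2).const_mul 3).mul hg1).smul (hC.hasDerivWithinAt_ξDerivIter hf 2 hp))).add
    ((hg.pow 3).smul (hC.hasDerivWithinAt_ξDerivIter hf 3 hp))
  rw [iteratedDerivWithin_succ]
  have e : EqOn (iteratedDerivWithin 3 f (Icc 0 1)) _ (Icc 0 1) :=
    fun q hq => hC.iteratedDerivWithin_three_ξDerivIter hf hq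
  rw [derivWithin_congr e (e hp)]
  refine (h.derivWithin (uniqueDiffOn_Icc01 p hp)).trans ?_
  simp only [ξDerivIter_zero, smul_eq_mul, Pi.mul_apply, Pi.pow_apply, Pi.add_apply]
  module

/-- Vanishing of the derivatives with respect to the parameter up to order three is vanishing of
the derivatives with respect to fully affine arc length. -/
theorem ξDerivIter_eq_zero (hC : IsRegularCurve C) (hf : ContDiffOn ℝ ∞ f (Icc 0 1)) {p : ℝ}
    (hp : p ∈ Icc (0 : ℝ) 1) (h : ∀ i ≤ 3, iteratedDerivWithin i f (Icc 0 1) p = 0) :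
    ∀ i ≤ 3, ξDerivIter i C f p = 0 := by
  have hg := (hC.g_pos hp).ne'
  have h0 : f p = 0 := by simpa using h 0 (by norm_num)
  have h1 : ξDerivIter 1 C f p = 0 := by
    have := h 1 (by norm_num)
    rw [hC.iteratedDerivWithin_one_ξDerivIter hf hp] at this
    exact (smul_eq_zero.1 this).resolve_left hg
  have h2 : ξDerivIter 2 C f p = 0 := by
    have := h 2 (by norm_num)
    rw [hC.iteratedDerivWithin_two_ξDerivIter hf hp, h1, smul_zero, zero_add] at this
    exact (smul_eq_zero.1 this).resolve_left (pow_ne_zero _ hg)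
  have h3 : ξDerivIter 3 C f p = 0 := by
    have := h 3 le_rfl
    rw [hC.iteratedDerivWithin_three_ξDerivIter hf hp, h1, h2, smul_zero, smul_zero, zero_add,
      zero_add] at this
    exact (smul_eq_zero.1 this).resolve_left (pow_ne_zero _ hg)
  intro i hi
  interval_cases i
  exacts [h0, h1, h2, h3]

end Change

/-- `F` in terms of differentiation with respect to the arc length of a reference curve. -/
theorem F_eq_sq_mul (hC : IsRegularCurve C) {Y : ℝ → Fin 2 → ℝ}
    (hY : ContDiffOn ℝ ∞ Y (Icc 0 1)) {p : ℝ} (hp : p ∈ Icc (0 : ℝ) 1) :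
    F Y p = g C p ^ 2 * affineForm (ξDerivIter 1 C Y p) (ξDerivIter 2 C Y p)
      (ξDerivIter 3 C Y p) (ξDerivIter 4 C Y p) := by
  rw [F_eq_affineForm, pDeriv, pDeriv, pDeriv, pDeriv, hC.iteratedDerivWithin_one_ξDerivIter hY hp,
    hC.iteratedDerivWithin_two_ξDerivIter hY hp, hC.iteratedDerivWithin_three_ξDerivIter hY hp,
    hC.iteratedDerivWithin_four_ξDerivIter hY hp, affineForm_change _ _ _ _ (hC.g_pos hp).ne']

theorem bracket_ne_zero (hC : IsRegularCurve C) {p : ℝ} (hp : p ∈ Icc (0 : ℝ) 1) :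
    bracket (ξDerivIter 1 C C p) (ξDerivIter 2 C C p) ≠ 0 := by
  have h := hC.nondegenerate p hp
  rw [pDeriv, pDeriv, hC.iteratedDerivWithin_one_ξDerivIter hC.smooth hp,
    hC.iteratedDerivWithin_two_ξDerivIter hC.smooth hp] at h
  intro h0
  apply h
  simp only [bracket_add_right, bracket_smul_left, bracket_smul_right, bracket_self, h0]
  ring

theorem smooth_φ (hC : IsRegularCurve C) : ContDiffOn ℝ ∞ (φ C) (Icc 0 1) := by
  have b : ∀ k, ContDiffOn ℝ ∞ (fun p => bracket (ξDerivIter 1 C C p) (ξDerivIter k C C p))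
      (Icc 0 1) := fun k => ContDiffOn.bracket (hC.smooth_ξDerivIter hC.smooth 1)
        (hC.smooth_ξDerivIter hC.smooth k)
  exact (b 3).neg.div (b 2) fun p hp => hC.bracket_ne_zero hp

theorem sq_g (hC : IsRegularCurve C) {p : ℝ} (hp : p ∈ Icc (0 : ℝ) 1) :
    g C p ^ 2 = ε C p * F C p := by
  obtain ⟨e, -, h⟩ := hC.exists_sign
  rw [g, Real.sq_sqrt]
  rw [(h p hp).1]
  exact (h p hp).2.le

theorem sq_ε (hC : IsRegularCurve C) {p : ℝ} (hp : p ∈ Icc (0 : ℝ) 1) : ε C p ^ 2 = 1 := by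
  obtain ⟨e, he, h⟩ := hC.exists_sign
  rw [(h p hp).1, he]

/-- Arc length normalises the form: `F = g² x` and `g² = ε F` give `ε x = 1`. This is the relation
that fixes the remaining coefficient in the structure equation. -/
theorem affineForm_eq_ε (hC : IsRegularCurve C) {p : ℝ} (hp : p ∈ Icc (0 : ℝ) 1) :
    affineForm (ξDerivIter 1 C C p) (ξDerivIter 2 C C p)
      (ξDerivIter 3 C C p) (ξDerivIter 4 C C p) = ε C p := by
  have h := hC.F_eq_sq_mul hC.smooth hp
  rw [hC.sq_g hp] at h
  have hF := hC.noInflection p hp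
  have hε := hC.sq_ε hp
  set x := affineForm (ξDerivIter 1 C C p) (ξDerivIter 2 C C p)
    (ξDerivIter 3 C C p) (ξDerivIter 4 C C p)
  have h1 : ε C p * x = 1 := mul_left_cancel₀ hF (by linear_combination -h)
  linear_combination ε C p * h1 - x * hε

end IsRegularCurve

theorem affineForm_frame {u v : Fin 2 → ℝ} (h : bracket u v ≠ 0) (a b c d : ℝ) :
    affineForm u v (a • u + b • v) (c • u + d • v) = 3 * d - 5 * b ^ 2 - 12 * a := by
  rw [affineForm, div_eq_iff (pow_ne_zero 2 h)]
  simp only [bracket, Pi.add_apply, Pi.smul_apply, smul_eq_mul]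
  ring

/-- The coefficient of `C_ξ` in the structure equation `C_ξξξ = a C_ξ - φ C_ξξ`. -/
def structureCoeff (C : ℝ → Fin 2 → ℝ) (p : ℝ) : ℝ :=
  -(ε C p + 3 * ξDerivIter 1 C (φ C) p + 2 * φ C p ^ 2) / 9

/-! ### The structure equation. -/

namespace IsRegularCurve

variable {C : ℝ → Fin 2 → ℝ}

/-- The structure equation of the fully affine plane. -/
theorem ξDerivIter_three (hC : IsRegularCurve C) {p : ℝ} (hp : p ∈ Icc (0 : ℝ) 1) :
    ξDerivIter 3 C C p =
      structureCoeff C p • ξDerivIter 1 C C p + (-φ C p) • ξDerivIter 2 C C p := by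
  -- Cramer's rule gives `-φ` as the `C_ξξ` coefficient by definition; `A` is the still unknown
  -- coefficient of `C_ξ`.
  set A : ℝ → ℝ := fun q => bracket (ξDerivIter 3 C C q) (ξDerivIter 2 C C q) /
    bracket (ξDerivIter 1 C C q) (ξDerivIter 2 C C q) with hA
  have hAs : ContDiffOn ℝ ∞ A (Icc 0 1) :=
    (ContDiffOn.bracket (hC.smooth_ξDerivIter hC.smooth 3)
      (hC.smooth_ξDerivIter hC.smooth 2)).div
    (ContDiffOn.bracket (hC.smooth_ξDerivIter hC.smooth 1) (hC.smooth_ξDerivIter hC.smooth 2))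
    fun q hq => hC.bracket_ne_zero hq
  have h3 : ∀ q ∈ Icc (0 : ℝ) 1, ξDerivIter 3 C C q =
      A q • ξDerivIter 1 C C q + (-φ C q) • ξDerivIter 2 C C q := fun q hq => by
    refine (eq_smul_add_smul_of_bracket_ne_zero (hC.bracket_ne_zero hq) _).trans ?_
    simp only [hA, φ, neg_div, neg_neg]
  have h4 : ξDerivIter 4 C C p = (ξDeriv C A p - φ C p * A p) • ξDerivIter 1 C C p
      + (A p - ξDerivIter 1 C (φ C) p + φ C p ^ 2) • ξDerivIter 2 C C p := by
    have d := ((hC.hasDerivWithinAt hAs hp).smul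
        (hC.hasDerivWithinAt_ξDerivIter hC.smooth 1 hp)).add
      ((hC.hasDerivWithinAt_ξDerivIter hC.smooth_φ 0 hp).neg.smul
        (hC.hasDerivWithinAt_ξDerivIter hC.smooth 2 hp))
    rw [ξDerivIter_succ, ξDeriv_congr (fun _ _ => rfl) h3 hp]
    refine (hC.ξDeriv_eq hp (f₁ := fun q => ξDeriv C A q • ξDerivIter 1 C C q
      + A q • ξDerivIter 2 C C q - ξDerivIter 1 C (φ C) q • ξDerivIter 2 C C q
      - φ C q • ξDerivIter 3 C C q) (d.congr_deriv ?_)).trans ?_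
    · simp only [ξDerivIter_zero, smul_eq_mul, Pi.neg_apply]
      module
    · simp only [h3 p hp]
      module
  have hε := hC.affineForm_eq_ε hp
  rw [h4, h3 p hp, affineForm_frame (hC.bracket_ne_zero hp)] at hε
  -- The normalisation reads `3(A - φ_ξ + φ²) - 5φ² - 12A = ε`. The derivative of `A` does not
  -- enter, so this is a linear equation for `A`.
  have hAp : A p = structureCoeff C p := by
    rw [structureCoeff, ← hε]; ring
  rw [h3 p hp, hAp]

end IsRegularCurve

/-- The Euler-Lagrange expression of the fully affine length. -/
def eulerLagrange (C : ℝ → Fin 2 → ℝ) (p : ℝ) : ℝ :=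
  ξDerivIter 3 C (φ C) p + φ C p * ξDerivIter 2 C (φ C) p
    + (2 * φ C p ^ 2 + 3 * ξDerivIter 1 C (φ C) p + ε C p) / 9 * ξDerivIter 1 C (φ C) p

/-- Derivative of `affineForm`, for a base point in the form given by the structure equation. -/
theorem hasDerivWithinAt_affineForm {y₁ y₂ y₃ y₄ : ℝ → Fin 2 → ℝ} {u v : Fin 2 → ℝ} {s : Set ℝ}
    {t a b c d α₁ β₁ α₂ β₂ α₃ β₃ α₄ β₄ : ℝ} (huv : bracket u v ≠ 0)
    (e₁ : y₁ t = u) (e₂ : y₂ t = v) (e₃ : y₃ t = a • u + b • v) (e₄ : y₄ t = c • u + d • v)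
    (h₁ : HasDerivWithinAt y₁ (α₁ • u + β₁ • v) s t)
    (h₂ : HasDerivWithinAt y₂ (α₂ • u + β₂ • v) s t)
    (h₃ : HasDerivWithinAt y₃ (α₃ • u + β₃ • v) s t)
    (h₄ : HasDerivWithinAt y₄ (α₄ • u + β₄ • v) s t) :
    HasDerivWithinAt (fun τ => affineForm (y₁ τ) (y₂ τ) (y₃ τ) (y₄ τ))
      (3 * (α₁ * d - β₁ * c + β₄ - d * (α₁ + β₂))
        - 10 * b * (α₁ * b - a * β₁ + β₃ - b * (α₁ + β₂))
        + 12 * (α₂ * b - a * β₂ - α₃ + a * (α₁ + β₂))) s t := by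
  have b12 := h₁.bracket h₂
  have b14 := h₁.bracket h₄
  have b13 := h₁.bracket h₃
  have b23 := h₂.bracket h₃
  have hne : bracket (y₁ t) (y₂ t) ^ 2 ≠ 0 := by rw [e₁, e₂]; exact pow_ne_zero 2 huv
  refine (((((b12.const_mul 3).mul b14).sub ((b13.pow 2).const_mul 5)).add
    ((b12.const_mul 12).mul b23)).div (b12.pow 2) hne).congr_deriv ?_
  rw [div_eq_iff (pow_ne_zero 2 (by simpa using hne))]
  simp only [Pi.mul_apply, Pi.pow_apply, Pi.add_apply, Pi.sub_apply, e₁, e₂, e₃, e₄,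
    bracket_add_left, bracket_add_right, bracket_smul_left, bracket_smul_right, bracket_self,
    bracket_swap v u]
  ring

/-! ### Vector fields in the moving frame. -/

namespace IsRegularCurve

variable {C : ℝ → Fin 2 → ℝ}

/-- Smoothness is only in question for `ε`, which is replaced by its constant value on `[0,1]`. -/
theorem smooth_eulerLagrange (hC : IsRegularCurve C) :
    ContDiffOn ℝ ∞ (eulerLagrange C) (Icc 0 1) := by
  obtain ⟨e, -, he⟩ := hC.exists_sign
  have hφ := fun k => hC.smooth_ξDerivIter hC.smooth_φ k
  have : ContDiffOn ℝ ∞ (fun p => ξDerivIter 3 C (φ C) p + φ C p * ξDerivIter 2 C (φ C) p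
      + (2 * φ C p ^ 2 + 3 * ξDerivIter 1 C (φ C) p + e) / 9 * ξDerivIter 1 C (φ C) p)
      (Icc 0 1) :=
    ((hφ 3).add ((hφ 0).mul (hφ 2))).add (((((contDiffOn_const.mul ((hφ 0).pow 2)).add
      (contDiffOn_const.mul (hφ 1))).add contDiffOn_const).div_const 9).mul (hφ 1))
  exact this.congr fun p hp => by rw [eulerLagrange, (he p hp).1]

theorem smooth_structureCoeff (hC : IsRegularCurve C) :
    ContDiffOn ℝ ∞ (structureCoeff C) (Icc 0 1) := by
  obtain ⟨e, -, he⟩ := hC.exists_sign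
  have hφ := fun k => hC.smooth_ξDerivIter hC.smooth_φ k
  have : ContDiffOn ℝ ∞ (fun p => -(e + 3 * ξDerivIter 1 C (φ C) p + 2 * φ C p ^ 2) / 9)
      (Icc 0 1) :=
    ((contDiffOn_const.add (contDiffOn_const.mul (hφ 1))).add
      (contDiffOn_const.mul ((hφ 0).pow 2))).neg.div_const 9
  exact this.congr fun p hp => by rw [structureCoeff, (he p hp).1]

theorem ξDerivIter_one_structureCoeff (hC : IsRegularCurve C) {p : ℝ} (hp : p ∈ Icc (0 : ℝ) 1) :
    ξDerivIter 1 C (structureCoeff C) p =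
      -(3 * ξDerivIter 2 C (φ C) p + 4 * φ C p * ξDerivIter 1 C (φ C) p) / 9 := by
  obtain ⟨e, -, he⟩ := hC.exists_sign
  have hφ := fun k => hC.hasDerivWithinAt_ξDerivIter hC.smooth_φ k hp
  have hcongr : EqOn (structureCoeff C)
      (fun p => -(e + 3 * ξDerivIter 1 C (φ C) p + 2 * φ C p ^ 2) / 9) (Icc 0 1) :=
    fun q hq => by rw [structureCoeff, (he q hq).1]
  rw [ξDerivIter_succ, ξDerivIter_zero, ξDeriv_congr (fun _ _ => rfl) hcongr hp]
  refine hC.ξDeriv_eq (f₁ := fun p => -(3 * ξDerivIter 2 C (φ C) p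
    + 4 * φ C p * ξDerivIter 1 C (φ C) p) / 9) hp (((((hasDerivWithinAt_const p _ e).add
    ((hφ 1).const_mul 3)).add (((hφ 0).pow 2).const_mul 2)).neg.div_const 9).congr_deriv ?_)
  simp only [ξDerivIter_zero, smul_eq_mul]
  ring

theorem ξDerivIter_two_structureCoeff (hC : IsRegularCurve C) {p : ℝ} (hp : p ∈ Icc (0 : ℝ) 1) :
    ξDerivIter 2 C (structureCoeff C) p =
      -(3 * ξDerivIter 3 C (φ C) p + 4 * ξDerivIter 1 C (φ C) p ^ 2
        + 4 * φ C p * ξDerivIter 2 C (φ C) p) / 9 := by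
  have hφ := fun k => hC.hasDerivWithinAt_ξDerivIter hC.smooth_φ k hp
  rw [ξDerivIter_succ, ξDeriv_congr (fun _ _ => rfl)
    (fun q hq => hC.ξDerivIter_one_structureCoeff hq) hp]
  refine hC.ξDeriv_eq (f₁ := fun p => -(3 * ξDerivIter 3 C (φ C) p
    + 4 * ξDerivIter 1 C (φ C) p ^ 2 + 4 * φ C p * ξDerivIter 2 C (φ C) p) / 9) hp
    (((((hφ 2).const_mul 3).add
    (((hφ 0).const_mul 4).mul (hφ 1))).neg.div_const 9).congr_deriv ?_)
  simp only [ξDerivIter_zero, smul_eq_mul]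
  ring

/-- Differentiation of a vector field along the curve in the frame `C_ξ, C_ξξ`. -/
theorem ξDeriv_frame (hC : IsRegularCurve C) {Y : ℝ → Fin 2 → ℝ} {α β : ℝ → ℝ} {α' β' p : ℝ}
    (hp : p ∈ Icc (0 : ℝ) 1)
    (hY : EqOn Y (fun q => α q • ξDerivIter 1 C C q + β q • ξDerivIter 2 C C q) (Icc 0 1))
    (hα : HasDerivWithinAt α (g C p * α') (Icc 0 1) p)
    (hβ : HasDerivWithinAt β (g C p * β') (Icc 0 1) p) :
    ξDeriv C Y p = (α' + structureCoeff C p * β p) • ξDerivIter 1 C C p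
      + (β' + α p - φ C p * β p) • ξDerivIter 2 C C p := by
  have d := (hα.smul (hC.hasDerivWithinAt_ξDerivIter hC.smooth 1 hp)).add
    (hβ.smul (hC.hasDerivWithinAt_ξDerivIter hC.smooth 2 hp))
  rw [ξDeriv_congr (fun _ _ => rfl) hY hp]
  refine hC.ξDeriv_eq (f₁ := fun q => (α' + structureCoeff C p * β p) • ξDerivIter 1 C C p
      + (β' + α p - φ C p * β p) • ξDerivIter 2 C C p) hp (d.congr_deriv ?_)
  rw [hC.ξDerivIter_three hp]
  module

theorem ξDerivIter_four (hC : IsRegularCurve C) {p : ℝ} (hp : p ∈ Icc (0 : ℝ) 1) :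
    ξDerivIter 4 C C p =
      (ξDerivIter 1 C (structureCoeff C) p - structureCoeff C p * φ C p) • ξDerivIter 1 C C p
      + (structureCoeff C p - ξDerivIter 1 C (φ C) p + φ C p ^ 2) • ξDerivIter 2 C C p := by
  rw [ξDerivIter_succ, hC.ξDeriv_frame hp (fun q hq => hC.ξDerivIter_three hq)
    (hC.hasDerivWithinAt_ξDerivIter hC.smooth_structureCoeff 0 hp)
    ((hC.hasDerivWithinAt_ξDerivIter hC.smooth_φ 0 hp).neg.congr_deriv
      (mul_neg (g C p) (ξDerivIter 1 C (φ C) p)).symm)]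
  module

/-- The derivatives of a vector field `W C_ξ + U C_ξξ` in the frame `C_ξ, C_ξξ`. The auxiliary
functions `c k` and `b k` are the derivatives of the first pair of coefficients. -/
theorem ξDerivIter_field (hC : IsRegularCurve C) {X : ℝ → Fin 2 → ℝ} {w u c b f a : ℕ → ℝ → ℝ}
    (hX : EqOn X (fun q => w 0 q • ξDerivIter 1 C C q + u 0 q • ξDerivIter 2 C C q) (Icc 0 1))
    (hf : ∀ p, f 0 p = φ C p) (ha : ∀ p, a 0 p = structureCoeff C p)
    (hw' : ∀ k, ∀ p ∈ Icc (0 : ℝ) 1,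
      HasDerivWithinAt (w k) (g C p * w (k + 1) p) (Icc 0 1) p)
    (hu' : ∀ k, ∀ p ∈ Icc (0 : ℝ) 1,
      HasDerivWithinAt (u k) (g C p * u (k + 1) p) (Icc 0 1) p)
    (hc' : ∀ k, ∀ p ∈ Icc (0 : ℝ) 1,
      HasDerivWithinAt (c k) (g C p * c (k + 1) p) (Icc 0 1) p)
    (hb' : ∀ k, ∀ p ∈ Icc (0 : ℝ) 1,
      HasDerivWithinAt (b k) (g C p * b (k + 1) p) (Icc 0 1) p)
    (hf' : ∀ k, ∀ p ∈ Icc (0 : ℝ) 1,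
      HasDerivWithinAt (f k) (g C p * f (k + 1) p) (Icc 0 1) p)
    (ha' : ∀ k, ∀ p ∈ Icc (0 : ℝ) 1,
      HasDerivWithinAt (a k) (g C p * a (k + 1) p) (Icc 0 1) p)
    (hc : ∀ p ∈ Icc (0 : ℝ) 1, c 0 p = w 1 p + a 0 p * u 0 p)
    (hb : ∀ p ∈ Icc (0 : ℝ) 1, b 0 p = u 1 p + w 0 p - f 0 p * u 0 p) :
    ∀ p ∈ Icc (0 : ℝ) 1,
      ξDerivIter 1 C X p = c 0 p • ξDerivIter 1 C C p + b 0 p • ξDerivIter 2 C C p ∧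
      ξDerivIter 2 C X p = (c 1 p + a 0 p * b 0 p) • ξDerivIter 1 C C p
        + (b 1 p + c 0 p - f 0 p * b 0 p) • ξDerivIter 2 C C p ∧
      ξDerivIter 3 C X p = (c 2 p + a 1 p * b 0 p + a 0 p * b 1 p
          + a 0 p * (b 1 p + c 0 p - f 0 p * b 0 p)) • ξDerivIter 1 C C p
        + (b 2 p + c 1 p - f 1 p * b 0 p - f 0 p * b 1 p + (c 1 p + a 0 p * b 0 p)
          - f 0 p * (b 1 p + c 0 p - f 0 p * b 0 p)) • ξDerivIter 2 C C p ∧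
      ∃ α : ℝ, ξDerivIter 4 C X p = α • ξDerivIter 1 C C p
        + (b 3 p + c 2 p - f 2 p * b 0 p - 2 * f 1 p * b 1 p - f 0 p * b 2 p
          + (c 2 p + a 1 p * b 0 p + a 0 p * b 1 p)
          - f 1 p * (b 1 p + c 0 p - f 0 p * b 0 p)
          - f 0 p * (b 2 p + c 1 p - f 1 p * b 0 p - f 0 p * b 1 p)
          + (c 2 p + a 1 p * b 0 p + a 0 p * b 1 p + a 0 p * (b 1 p + c 0 p - f 0 p * b 0 p))
          - f 0 p * (b 2 p + c 1 p - f 1 p * b 0 p - f 0 p * b 1 p + (c 1 p + a 0 p * b 0 p)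
          - f 0 p * (b 1 p + c 0 p - f 0 p * b 0 p))) • ξDerivIter 2 C C p := by
  have s1 : EqOn (ξDerivIter 1 C X)
      (fun q => c 0 q • ξDerivIter 1 C C q + b 0 q • ξDerivIter 2 C C q) (Icc 0 1) := by
    intro p hp
    rw [ξDerivIter_succ, ξDerivIter_zero, hC.ξDeriv_frame hp hX (hw' 0 p hp) (hu' 0 p hp)]
    simp only [hc p hp, hb p hp, ha, hf]
  have s2 : EqOn (ξDerivIter 2 C X) (fun p => (c 1 p + a 0 p * b 0 p) • ξDerivIter 1 C C p
      + (b 1 p + c 0 p - f 0 p * b 0 p) • ξDerivIter 2 C C p) (Icc 0 1) := by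
    intro p hp
    rw [ξDerivIter_succ, hC.ξDeriv_frame hp s1 (hc' 0 p hp) (hb' 0 p hp)]
    simp only [ha, hf]
  have dα : ∀ p ∈ Icc (0 : ℝ) 1, HasDerivWithinAt (fun p => c 1 p + a 0 p * b 0 p)
      (g C p * (c 2 p + a 1 p * b 0 p + a 0 p * b 1 p)) (Icc 0 1) p := fun p hp =>
    ((hc' 1 p hp).add ((ha' 0 p hp).mul (hb' 0 p hp))).congr_deriv (by ring)
  have dβ : ∀ p ∈ Icc (0 : ℝ) 1, HasDerivWithinAt (fun p => b 1 p + c 0 p - f 0 p * b 0 p)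
      (g C p * (b 2 p + c 1 p - f 1 p * b 0 p - f 0 p * b 1 p)) (Icc 0 1) p := fun p hp =>
    (((hb' 1 p hp).add (hc' 0 p hp)).sub ((hf' 0 p hp).mul (hb' 0 p hp))).congr_deriv (by ring)
  have s3 : EqOn (ξDerivIter 3 C X) (fun p => (c 2 p + a 1 p * b 0 p + a 0 p * b 1 p
          + a 0 p * (b 1 p + c 0 p - f 0 p * b 0 p)) • ξDerivIter 1 C C p
        + (b 2 p + c 1 p - f 1 p * b 0 p - f 0 p * b 1 p + (c 1 p + a 0 p * b 0 p)
          - f 0 p * (b 1 p + c 0 p - f 0 p * b 0 p)) • ξDerivIter 2 C C p) (Icc 0 1) := by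
    intro p hp
    rw [ξDerivIter_succ, hC.ξDeriv_frame hp s2 (dα p hp) (dβ p hp)]
    simp only [ha, hf]
  intro p hp
  have h4 := hC.ξDeriv_frame hp s3
      (α' := c 3 p + a 2 p * b 0 p + a 1 p * b 1 p + a 1 p * b 1 p + a 0 p * b 2 p
        + a 1 p * (b 1 p + c 0 p - f 0 p * b 0 p)
        + a 0 p * (b 2 p + c 1 p - f 1 p * b 0 p - f 0 p * b 1 p))
      (β' := b 3 p + c 2 p - f 2 p * b 0 p - 2 * f 1 p * b 1 p - f 0 p * b 2 p
        + (c 2 p + a 1 p * b 0 p + a 0 p * b 1 p)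
        - f 1 p * (b 1 p + c 0 p - f 0 p * b 0 p)
        - f 0 p * (b 2 p + c 1 p - f 1 p * b 0 p - f 0 p * b 1 p))
      ((((hc' 2 p hp).add ((ha' 1 p hp).mul (hb' 0 p hp))).add
        ((ha' 0 p hp).mul (hb' 1 p hp))).add ((ha' 0 p hp).mul (dβ p hp)) |>.congr_deriv (by ring))
      (((((hb' 2 p hp).add (hc' 1 p hp)).sub ((hf' 1 p hp).mul (hb' 0 p hp))).sub
        ((hf' 0 p hp).mul (hb' 1 p hp))).add (dα p hp) |>.sub ((hf' 0 p hp).mul (dβ p hp))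
        |>.congr_deriv (by ring))
  rw [← ξDerivIter_succ, ← hf] at h4
  -- The `C_ξ` component of the fourth derivative may stay anonymous: it does not occur in the
  -- derivative of `affineForm`.
  exact ⟨s1 hp, s2 hp, s3 hp, _, h4⟩

end IsRegularCurve

/-! ### Leibniz rules for arc-length derivatives. -/

namespace IsRegularCurve

variable {C : ℝ → Fin 2 → ℝ}

section Leibniz

variable {f h : ℝ → ℝ}

theorem ξDerivIter_fun_add (hC : IsRegularCurve C) (hf : ContDiffOn ℝ ∞ f (Icc 0 1))
    (hh : ContDiffOn ℝ ∞ h (Icc 0 1)) (k : ℕ) :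
    EqOn (ξDerivIter k C (fun p => f p + h p)) (fun p => ξDerivIter k C f p + ξDerivIter k C h p)
      (Icc 0 1) := by
  induction k with
  | zero => exact fun _ _ => rfl
  | succ k ih =>
    intro p hp
    rw [ξDerivIter_succ, ξDeriv_congr (fun _ _ => rfl) ih hp]
    refine hC.ξDeriv_eq (f₁ := fun p => ξDerivIter (k + 1) C f p + ξDerivIter (k + 1) C h p) hp
      (((hC.hasDerivWithinAt_ξDerivIter hf k hp).add
        (hC.hasDerivWithinAt_ξDerivIter hh k hp)).congr_deriv ?_)
    rw [smul_add]

theorem ξDerivIter_fun_sub (hC : IsRegularCurve C) (hf : ContDiffOn ℝ ∞ f (Icc 0 1))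
    (hh : ContDiffOn ℝ ∞ h (Icc 0 1)) (k : ℕ) :
    EqOn (ξDerivIter k C (fun p => f p - h p)) (fun p => ξDerivIter k C f p - ξDerivIter k C h p)
      (Icc 0 1) := by
  induction k with
  | zero => exact fun _ _ => rfl
  | succ k ih =>
    intro p hp
    rw [ξDerivIter_succ, ξDeriv_congr (fun _ _ => rfl) ih hp]
    refine hC.ξDeriv_eq (f₁ := fun p => ξDerivIter (k + 1) C f p - ξDerivIter (k + 1) C h p) hp
      (((hC.hasDerivWithinAt_ξDerivIter hf k hp).sub
        (hC.hasDerivWithinAt_ξDerivIter hh k hp)).congr_deriv ?_)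
    rw [smul_sub]

theorem ξDerivIter_one_mul (hC : IsRegularCurve C) (hf : ContDiffOn ℝ ∞ f (Icc 0 1))
    (hh : ContDiffOn ℝ ∞ h (Icc 0 1)) :
    EqOn (ξDerivIter 1 C (fun p => f p * h p))
      (fun p => ξDerivIter 1 C f p * h p + f p * ξDerivIter 1 C h p) (Icc 0 1) := by
  intro p hp
  refine hC.ξDeriv_eq hp (f₁ := fun p => ξDerivIter 1 C f p * h p + f p * ξDerivIter 1 C h p)
    (((hC.hasDerivWithinAt_ξDerivIter hf 0 hp).mul
      (hC.hasDerivWithinAt_ξDerivIter hh 0 hp)).congr_deriv ?_)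
  simp only [ξDerivIter_zero, smul_eq_mul]
  ring

theorem ξDerivIter_two_mul (hC : IsRegularCurve C) (hf : ContDiffOn ℝ ∞ f (Icc 0 1))
    (hh : ContDiffOn ℝ ∞ h (Icc 0 1)) :
    EqOn (ξDerivIter 2 C (fun p => f p * h p))
      (fun p => ξDerivIter 2 C f p * h p + 2 * ξDerivIter 1 C f p * ξDerivIter 1 C h p
        + f p * ξDerivIter 2 C h p) (Icc 0 1) := by
  have df := fun k => fun {p} hp => hC.hasDerivWithinAt_ξDerivIter hf k (p := p) hp
  have dh := fun k => fun {p} hp => hC.hasDerivWithinAt_ξDerivIter hh k (p := p) hp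
  intro p hp
  rw [ξDerivIter_succ, ξDeriv_congr (fun _ _ => rfl) (hC.ξDerivIter_one_mul hf hh) hp]
  refine hC.ξDeriv_eq hp (f₁ := fun p => ξDerivIter 2 C f p * h p
    + 2 * ξDerivIter 1 C f p * ξDerivIter 1 C h p + f p * ξDerivIter 2 C h p)
    ((((df 1 hp).mul (dh 0 hp)).add ((df 0 hp).mul (dh 1 hp))).congr_deriv ?_)
  simp only [ξDerivIter_zero, smul_eq_mul]
  ring

theorem ξDerivIter_three_mul (hC : IsRegularCurve C) (hf : ContDiffOn ℝ ∞ f (Icc 0 1))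
    (hh : ContDiffOn ℝ ∞ h (Icc 0 1)) :
    EqOn (ξDerivIter 3 C (fun p => f p * h p))
      (fun p => ξDerivIter 3 C f p * h p + 3 * ξDerivIter 2 C f p * ξDerivIter 1 C h p
        + 3 * ξDerivIter 1 C f p * ξDerivIter 2 C h p + f p * ξDerivIter 3 C h p)
      (Icc 0 1) := by
  have df := fun k => fun {p} hp => hC.hasDerivWithinAt_ξDerivIter hf k (p := p) hp
  have dh := fun k => fun {p} hp => hC.hasDerivWithinAt_ξDerivIter hh k (p := p) hp
  intro p hp
  rw [ξDerivIter_succ, ξDeriv_congr (fun _ _ => rfl) (hC.ξDerivIter_two_mul hf hh) hp]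
  refine hC.ξDeriv_eq hp (f₁ := fun p => ξDerivIter 3 C f p * h p
    + 3 * ξDerivIter 2 C f p * ξDerivIter 1 C h p
    + 3 * ξDerivIter 1 C f p * ξDerivIter 2 C h p + f p * ξDerivIter 3 C h p)
    (((((df 2 hp).mul (dh 0 hp)).add (((df 1 hp).const_mul 2).mul (dh 1 hp))).add
      ((df 0 hp).mul (dh 2 hp))).congr_deriv ?_)
  simp only [ξDerivIter_zero, smul_eq_mul]
  ring

end Leibniz

end IsRegularCurve

/-- The boundary term in the first variation of the fully affine length. -/
def boundaryTerm (C : ℝ → Fin 2 → ℝ) (W U : ℝ → ℝ) (e p : ℝ) : ℝ :=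
  2 * e * W p + 3 * ξDerivIter 3 C U p - 2 * φ C p * ξDerivIter 2 C U p
    + (7 / 3 * e - 1 / 3 * φ C p ^ 2 - 6 * ξDerivIter 1 C (φ C) p) * ξDerivIter 1 C U p
    + (-(17 / 9) * e * φ C p + 2 / 9 * φ C p ^ 3 + 5 / 3 * φ C p * ξDerivIter 1 C (φ C) p
      - ξDerivIter 2 C (φ C) p) * U p

/-! ### The first variation. -/

namespace IsRegularCurve

variable {C : ℝ → Fin 2 → ℝ}

theorem hasDerivWithinAt_boundaryTerm (hC : IsRegularCurve C) {W U : ℝ → ℝ}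
    (hW : ContDiffOn ℝ ∞ W (Icc 0 1)) (hU : ContDiffOn ℝ ∞ U (Icc 0 1)) (e : ℝ) {p : ℝ}
    (hp : p ∈ Icc (0 : ℝ) 1) :
    HasDerivWithinAt (boundaryTerm C W U e)
      (g C p * (2 * e * ξDerivIter 1 C W p + 3 * ξDerivIter 4 C U p
        - 2 * φ C p * ξDerivIter 3 C U p
        + (7 / 3 * e - 1 / 3 * φ C p ^ 2 - 8 * ξDerivIter 1 C (φ C) p) * ξDerivIter 2 C U p
        + (-(17 / 9) * e * φ C p + 2 / 9 * φ C p ^ 3 + φ C p * ξDerivIter 1 C (φ C) p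
          - 7 * ξDerivIter 2 C (φ C) p) * ξDerivIter 1 C U p
        + (-(17 / 9) * e * ξDerivIter 1 C (φ C) p + 2 / 3 * φ C p ^ 2 * ξDerivIter 1 C (φ C) p
          + 5 / 3 * ξDerivIter 1 C (φ C) p ^ 2 + 5 / 3 * φ C p * ξDerivIter 2 C (φ C) p
          - ξDerivIter 3 C (φ C) p) * U p)) (Icc 0 1) p := by
  have dW := fun k => hC.hasDerivWithinAt_ξDerivIter hW k hp
  have dU := fun k => hC.hasDerivWithinAt_ξDerivIter hU k hp
  have df := fun k => hC.hasDerivWithinAt_ξDerivIter hC.smooth_φ k hp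
  have c₁ := (((df 0).pow 2).const_mul (1 / 3)).const_sub (7 / 3 * e) |>.sub ((df 1).const_mul 6)
  have c₀ := ((((df 0).const_mul (-(17 / 9) * e)).add (((df 0).pow 3).const_mul (2 / 9))).add
    (((df 0).const_mul (5 / 3)).mul (df 1))).sub (df 2)
  refine ((((((dW 0).const_mul (2 * e)).add ((dU 3).const_mul 3)).sub
    (((df 0).const_mul 2).mul (dU 2))).add (c₁.mul (dU 1))).add (c₀.mul (dU 0))).congr_deriv ?_
  simp only [ξDerivIter_zero, smul_eq_mul, Pi.add_apply, Pi.sub_apply, Pi.mul_apply, Pi.pow_apply]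
  ring

/-- The pointwise first variation of the fully affine density. -/
theorem hasDerivWithinAt_affineForm_field (hC : IsRegularCurve C) {W U : ℝ → ℝ}
    {X : ℝ → Fin 2 → ℝ} (hW : ContDiffOn ℝ ∞ W (Icc 0 1)) (hU : ContDiffOn ℝ ∞ U (Icc 0 1))
    (hX : EqOn X (fun q => W q • ξDerivIter 1 C C q + U q • ξDerivIter 2 C C q) (Icc 0 1))
    {p : ℝ} (hp : p ∈ Icc (0 : ℝ) 1) {y : ℕ → ℝ → Fin 2 → ℝ} {s : Set ℝ} {t : ℝ}
    (hy : ∀ k, y k t = ξDerivIter k C C p)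
    (hy' : ∀ k, HasDerivWithinAt (y k) (ξDerivIter k C X p) s t) :
    ∃ d, HasDerivWithinAt (fun τ => affineForm (y 1 τ) (y 2 τ) (y 3 τ) (y 4 τ)) d s t ∧
      HasDerivWithinAt (boundaryTerm C W U (ε C p)) (g C p * (d + U p * eulerLagrange C p))
        (Icc 0 1) p := by
  have hφ := hC.smooth_φ
  have ha := hC.smooth_structureCoeff
  have hU1 := hC.smooth_ξDerivIter hU 1
  have hW1 := hC.smooth_ξDerivIter hW 1
  have haU := ha.mul hU
  have hφU := hφ.mul hU
  set c : ℝ → ℝ := fun q => ξDerivIter 1 C W q + structureCoeff C q * U q with hc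
  set b : ℝ → ℝ := fun q => ξDerivIter 1 C U q + W q - φ C q * U q with hb
  have hcs : ContDiffOn ℝ ∞ c (Icc 0 1) := hW1.add haU
  have hbs : ContDiffOn ℝ ∞ b (Icc 0 1) := (hU1.add hW).sub hφU
  have dd : ∀ {f : ℝ → ℝ}, ContDiffOn ℝ ∞ f (Icc 0 1) → ∀ k, ∀ p ∈ Icc (0 : ℝ) 1,
      HasDerivWithinAt (ξDerivIter k C f) (g C p * ξDerivIter (k + 1) C f p) (Icc 0 1) p :=
    fun hf k p hp => hC.hasDerivWithinAt_ξDerivIter hf k hp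
  obtain ⟨x₁, x₂, x₃, α, x₄⟩ := hC.ξDerivIter_field (w := fun k => ξDerivIter k C W)
    (u := fun k => ξDerivIter k C U) (c := fun k => ξDerivIter k C c)
    (b := fun k => ξDerivIter k C b) (f := fun k => ξDerivIter k C (φ C))
    (a := fun k => ξDerivIter k C (structureCoeff C)) hX (fun _ => rfl) (fun _ => rfl)
    (dd hW) (dd hU) (dd hcs) (dd hbs) (dd hφ) (dd ha) (fun _ _ => rfl) (fun _ _ => rfl) p hp
  have ec : ∀ k, ξDerivIter k C c p =
      ξDerivIter (k + 1) C W p + ξDerivIter k C (fun q => structureCoeff C q * U q) p := fun k => by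
    rw [hC.ξDerivIter_fun_add hW1 haU k hp, ξDerivIter_add]
  have eb : ∀ k, ξDerivIter k C b p = ξDerivIter (k + 1) C U p + ξDerivIter k C W p
      - ξDerivIter k C (fun q => φ C q * U q) p := fun k => by
    rw [hC.ξDerivIter_fun_sub (hU1.add hW) hφU k hp]
    simp only [hC.ξDerivIter_fun_add hU1 hW k hp, ξDerivIter_add]
  have key := hasDerivWithinAt_affineForm (hC.bracket_ne_zero hp) (hy 1) (hy 2)
    ((hy 3).trans (hC.ξDerivIter_three hp)) ((hy 4).trans (hC.ξDerivIter_four hp))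
    ((hy' 1).congr_deriv x₁) ((hy' 2).congr_deriv x₂) ((hy' 3).congr_deriv x₃)
    ((hy' 4).congr_deriv x₄)
  refine ⟨_, key, (hC.hasDerivWithinAt_boundaryTerm hW hU (ε C p) hp).congr_deriv ?_⟩
  congr 1
  -- Everything becomes a polynomial in `ε` and the arc-length derivatives of `W`, `U`, `φ`. The
  -- tangential part contributes only `2 ε W_ξ`, an exact derivative.
  simp only [ec, eb, hC.ξDerivIter_one_mul ha hU hp, hC.ξDerivIter_two_mul ha hU hp,
    hC.ξDerivIter_one_mul hφ hU hp, hC.ξDerivIter_two_mul hφ hU hp,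
    hC.ξDerivIter_three_mul hφ hU hp, hC.ξDerivIter_one_structureCoeff hp,
    hC.ξDerivIter_two_structureCoeff hp, ξDerivIter_zero, Nat.reduceAdd]
  simp only [structureCoeff, eulerLagrange]
  ring

end IsRegularCurve

/-- The first variation of the fully affine length. -/
theorem IsDeformation.hasDerivWithinAt_length {C : ℝ → Fin 2 → ℝ} {T : ℝ}
    {Γ : ℝ → ℝ → Fin 2 → ℝ} {W U : ℝ → ℝ → ℝ} (hC : IsRegularCurve C) (hT : 0 < T)
    (h : IsDeformation C T Γ W U) {e : ℝ} (he : ∀ p ∈ Icc (0 : ℝ) 1, ε C p = e) :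
    HasDerivWithinAt (fun t => length (fun p => Γ p t))
      (-(e / 2) * ∫ p in (0 : ℝ)..1, g C p * (U p 0 * eulerLagrange C p)) (Ico 0 T) 0 := by
  have hΓ := h.isRegularFamily
  have h0 : (0 : ℝ) ∈ Ico 0 T := left_mem_Ico.2 hT
  have hini : EqOn (fun p => Γ p 0) C (Icc 0 1) := h.initial
  have hU : ContDiffOn ℝ ∞ (fun p => U p 0) (Icc 0 1) := SmoothFamily.slice h.smooth_U h0
  have hW : ContDiffOn ℝ ∞ (fun p => W p 0) (Icc 0 1) := SmoothFamily.slice h.smooth_W h0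
  obtain ⟨e', he'2, he'⟩ := hΓ.exists_sign
  have hee : e' = e := by
    have hz : (0 : ℝ) ∈ Icc (0 : ℝ) 1 := ⟨le_rfl, zero_le_one⟩
    rw [← he 0 hz, ← (he' 0 hz 0 h0).1, ε, ε, F_congr hini hz]
  subst hee
  have hX : EqOn (fun q => partialT T Γ q 0) (fun q => W q 0 • ξDerivIter 1 C C q
      + U q 0 • ξDerivIter 2 C C q) (Icc 0 1) := fun q hq => by
    have := (h.evolution q hq 0 h0).derivWithin (uniqueDiffOn_Ico0 T 0 h0)
    rw [ξDerivIter_congr hini hini 1 hq, ξDerivIter_congr hini hini 2 hq] at this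
    exact this
  have hB : ∀ p ∈ Icc (0 : ℝ) 1, HasDerivWithinAt
      (boundaryTerm C (fun p => W p 0) (fun p => U p 0) e')
      (2 * e' * partialT T (fun p t => g (fun q => Γ q t) p) p 0
        + g C p * (U p 0 * eulerLagrange C p)) (Icc 0 1) p := by
    intro p hp
    obtain ⟨d, hd, hB⟩ := hC.hasDerivWithinAt_affineForm_field hW hU hX hp (s := Ico 0 T) (t := 0)
      (y := fun k s => ξDerivIter k C (fun q => Γ q s) p)
      (fun k => ξDerivIter_congr (fun _ _ => rfl) hini k hp)
      (fun k => hC.partialT_ξDerivIter h.smooth k hp h0)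
    have hg0 := hC.g_pos hp
    -- The reference arc length is that of `C` for every `t`, so the factor `g C p ^ 2` is constant
    -- in `t`.
    have hF : HasDerivWithinAt (fun t => F (fun q => Γ q t) p) (g C p ^ 2 * d) (Ico 0 T) 0 :=
      (hd.const_mul (g C p ^ 2)).congr
        (fun t ht => hC.F_eq_sq_mul (SmoothFamily.slice h.smooth ht) hp)
        (hC.F_eq_sq_mul (SmoothFamily.slice h.smooth h0) hp)
    have hgd : HasDerivWithinAt (fun t => g (fun q => Γ q t) p) (e' * (g C p ^ 2 * d) /
        (2 * g C p)) (Ico 0 T) 0 := by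
      have hg : ∀ t ∈ Ico 0 T, g (fun q => Γ q t) p = Real.sqrt (e' * F (fun q => Γ q t) p) :=
        fun t ht => by rw [g, (he' p hp t ht).1]
      have := ((hF.const_mul e').sqrt (he' p hp 0 h0).2.ne').congr hg (hg 0 h0)
      rwa [← hg 0 h0, g_congr hini hp] at this
    have hgt : partialT T (fun p t => g (fun q => Γ q t) p) p 0 = _ :=
      hgd.derivWithin (uniqueDiffOn_Ico0 T 0 h0)
    rw [he p hp] at hB
    refine hB.congr_deriv ?_
    -- The derivative of the square root is `e' g d / 2`, so `2 e' g_t = g d` by `e' ^ 2 = 1`.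
    rw [hgt]
    field_simp
    rw [he'2]
    ring
  have hgs := hΓ.smooth_g
  have hi1 : IntervalIntegrable (fun p => partialT T (fun p t => g (fun q => Γ q t) p) p 0)
      MeasureTheory.volume 0 1 := ContinuousOn.intervalIntegrable (by
    rw [uIcc_of_le zero_le_one]; exact (hgs.partialT.slice h0).continuousOn)
  have hi2 : IntervalIntegrable (fun p => g C p * (U p 0 * eulerLagrange C p))
      MeasureTheory.volume 0 1 := ContinuousOn.intervalIntegrable (by
    rw [uIcc_of_le zero_le_one]
    exact (hC.smooth_g.mul (hU.mul hC.smooth_eulerLagrange)).continuousOn)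
  have hbd : ∀ p ∈ Icc (0 : ℝ) 1, W p 0 = 0 →
      (∀ i ≤ 3, iteratedDerivWithin i (fun p => U p 0) (Icc 0 1) p = 0) →
      boundaryTerm C (fun p => W p 0) (fun p => U p 0) e' p = 0 := by
    intro p hp hWp hUp
    have hz := hC.ξDerivIter_eq_zero hU hp hUp
    have hz0 : U p 0 = 0 := hz 0 (by norm_num)
    simp only [boundaryTerm, hWp, hz0, hz 1 (by norm_num), hz 2 (by norm_num), hz 3 le_rfl]
    ring
  -- The boundary term involves `W` and `U` up to `U_ξξξ`, exactly what vanishes at both endpoints;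
  -- hence `2 e' ∫ g_t + ∫ g U · eulerLagrange = 0`.
  have hftc := intervalIntegral.integral_eq_sub_of_hasDeriv_right_of_le zero_le_one
    (fun p hp => (hB p hp).continuousWithinAt)
    (fun p hp => ((hB p (Ioo_subset_Icc_self hp)).hasDerivAt
      (Icc_mem_nhds hp.1 hp.2)).hasDerivWithinAt)
    ((hi1.const_mul (2 * e')).add hi2)
  rw [hbd 1 ⟨zero_le_one, le_rfl⟩ (h.boundary_W 0 h0).2 (fun i hi => (h.boundary_U 0 h0 i hi).2),
    hbd 0 ⟨le_rfl, zero_le_one⟩ (h.boundary_W 0 h0).1 (fun i hi => (h.boundary_U 0 h0 i hi).1),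
    intervalIntegral.integral_add (hi1.const_mul _) hi2, intervalIntegral.integral_const_mul]
    at hftc
  refine (hgs.hasDerivWithinAt_integral hT).congr_deriv ?_
  linear_combination (e' / 2) * hftc - (∫ p in (0 : ℝ)..1,
    partialT T (fun p t => g (fun q => Γ q t) p) p 0) * he'2

/-! ### Construction of admissible deformations and the Euler–Lagrange equation. -/

theorem SmoothFamily.mono {V : Type*} [NormedAddCommGroup V] [NormedSpace ℝ V] {T T' : ℝ}
    {f : ℝ → ℝ → V} (hf : SmoothFamily T f) (h : T' ≤ T) : SmoothFamily T' f :=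
  ContDiffOn.mono hf (prod_mono le_rfl (Ico_subset_Ico_right h))

/-- Regularity of a curve is an open condition along smooth families. -/
theorem SmoothFamily.exists_isRegularFamily {T : ℝ} (hT : 0 < T) {Γ : ℝ → ℝ → Fin 2 → ℝ}
    (hΓ : SmoothFamily T Γ) (h0 : IsRegularCurve (fun p => Γ p 0)) :
    ∃ T' > 0, T' ≤ T ∧ IsRegularFamily T' Γ := by
  set D : ℕ → ℕ → ℝ × ℝ → ℝ := fun i j x =>
    bracket (pDeriv i (fun q => Γ q x.2) x.1) (pDeriv j (fun q => Γ q x.2) x.1) with hD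
  have hDc : ∀ i j, ContinuousOn (D i j) (Icc 0 1 ×ˢ Ico 0 T) := fun i j =>
    ContDiffOn.continuousOn (n := ∞) (ContDiffOn.bracket (hΓ.pDeriv i) (hΓ.pDeriv j))
  set N : ℝ × ℝ → ℝ := fun x =>
    3 * D 1 2 x * D 1 4 x - 5 * D 1 3 x ^ 2 + 12 * D 1 2 x * D 2 3 x with hN
  have hNc : ContinuousOn N (Icc 0 1 ×ˢ Ico 0 T) :=
    (((continuousOn_const.mul (hDc 1 2)).mul (hDc 1 4)).sub
      (continuousOn_const.mul ((hDc 1 3).pow 2))).add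
      ((continuousOn_const.mul (hDc 1 2)).mul (hDc 2 3))
  have hF : ∀ p t, F (fun q => Γ q t) p = N (p, t) / D 1 2 (p, t) ^ 2 := fun _ _ => rfl
  -- The product `D 1 2 * N` being nonzero encodes both regularity conditions; compactness of
  -- `[0,1]` makes the time interval uniform in `p`.
  have hev : ∀ᶠ t in nhds (0 : ℝ), ∀ p ∈ Icc (0 : ℝ) 1,
      ((p, t) ∈ Icc (0 : ℝ) 1 ×ˢ Ico 0 T → D 1 2 (p, t) * N (p, t) ≠ 0) := by
    refine isCompact_Icc.eventually_forall_of_forall_eventually fun p hp => ?_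
    have hx : (p, (0 : ℝ)) ∈ Icc (0 : ℝ) 1 ×ˢ Ico 0 T := ⟨hp, left_mem_Ico.2 hT⟩
    have hne : D 1 2 (p, 0) * N (p, 0) ≠ 0 := by
      refine mul_ne_zero (h0.nondegenerate p hp) fun hN0 => h0.noInflection p hp ?_
      rw [hF, hN0, zero_div]
    have h1 := (((hDc 1 2).mul hNc) (p, 0) hx).eventually_ne hne
    rw [eventually_nhdsWithin_iff] at h1
    exact (continuous_swap.tendsto ((0 : ℝ), p)).eventually h1
  obtain ⟨δ, hδ, hball⟩ := Metric.eventually_nhds_iff.1 hev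
  refine ⟨min δ T, lt_min hδ hT, min_le_right _ _, hΓ.mono (min_le_right _ _), fun t ht => ?_⟩
  have ht' : t ∈ Ico 0 T := ⟨ht.1, ht.2.trans_le (min_le_right _ _)⟩
  have hne : ∀ p ∈ Icc (0 : ℝ) 1, D 1 2 (p, t) * N (p, t) ≠ 0 := fun p hp =>
    hball (by rw [Real.dist_0_eq_abs, abs_of_nonneg ht.1]
              exact ht.2.trans_le (min_le_left _ _)) p hp ⟨hp, ht'⟩
  refine ⟨hΓ.slice ht', fun p hp => left_ne_zero_of_mul (hne p hp), fun p hp => ?_⟩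
  rw [hF]
  exact div_ne_zero (right_ne_zero_of_mul (hne p hp))
    (pow_ne_zero 2 (left_ne_zero_of_mul (hne p hp)))

theorem iteratedDerivWithin_eq_zero_of_eventually {u : ℝ → ℝ} {s : Set ℝ} {p : ℝ}
    (h : ∀ᶠ q in nhds p, u q = 0) (i : ℕ) : iteratedDerivWithin i u s p = 0 := by
  have h1 : u =ᶠ[nhdsWithin p s] fun _ => (0 : ℝ) := h.filter_mono nhdsWithin_le_nhds
  rw [h1.iteratedDerivWithin_eq h.self_of_nhds, iteratedDerivWithin_const, ite_self]

/-- Every test function is the normal speed of an admissible deformation. -/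
theorem IsRegularCurve.exists_isDeformation {C : ℝ → Fin 2 → ℝ} (hC : IsRegularCurve C)
    {η : ℝ → ℝ} (hη : ContDiff ℝ ∞ η) (hsupp : tsupport η ⊆ Ioo 0 1) :
    ∃ (T : ℝ) (Γ : ℝ → ℝ → Fin 2 → ℝ) (W U : ℝ → ℝ → ℝ), 0 < T ∧ IsDeformation C T Γ W U ∧
      ∀ p ∈ Icc (0 : ℝ) 1, U p 0 = η p := by
  set X : ℝ → Fin 2 → ℝ := fun p => η p • ξDerivIter 2 C C p with hX
  have hXs : ContDiffOn ℝ ∞ X (Icc 0 1) :=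
    hη.contDiffOn.smul (hC.smooth_ξDerivIter hC.smooth 2)
  set Γ : ℝ → ℝ → Fin 2 → ℝ := fun p t => C p + t • X p with hΓ
  have hini : (fun p => Γ p 0) = C := by ext1 p; simp [hΓ]
  have hXf : ∀ T, SmoothFamily T (fun p _ => X p) := fun T => SmoothFamily.of_slice hXs
  have hΓs : SmoothFamily 1 Γ := ContDiffOn.add (SmoothFamily.of_slice hC.smooth)
    (ContDiffOn.smul contDiff_snd.contDiffOn (hXf 1))
  obtain ⟨T, hT, -, hreg⟩ := hΓs.exists_isRegularFamily one_pos (by rw [hini]; exact hC)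
  set v : ℕ → ℝ → ℝ → Fin 2 → ℝ := fun k p t =>
    ξDerivIter k (fun q => Γ q t) (fun q => Γ q t) p with hv
  have hvs : ∀ k, SmoothFamily T (v k) := fun k => hreg.smooth_ξDerivIter hreg.smooth k
  have hvne : ∀ p ∈ Icc (0 : ℝ) 1, ∀ t ∈ Ico 0 T, bracket (v 1 p t) (v 2 p t) ≠ 0 :=
    fun p hp t ht => (hreg.regular t ht).bracket_ne_zero hp
  -- `X` vanishes on whole neighbourhoods of the endpoints, which kills all derivatives of `U`
  -- there.
  have hη0 : ∀ p ∉ Ioo (0 : ℝ) 1, ∀ᶠ q in nhds p, X q = 0 := fun p hp => by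
    have := notMem_tsupport_iff_eventuallyEq.1 (fun h => hp (hsupp h))
    filter_upwards [this] with q hq
    simp only [hX, hq, Pi.zero_apply, zero_smul]
  have hb0 : ∀ u : Fin 2 → ℝ, bracket 0 u = 0 ∧ bracket u 0 = 0 := fun u => by simp [bracket]
  have h00 : (0 : ℝ) ∉ Ioo (0 : ℝ) 1 := by simp
  have h11 : (1 : ℝ) ∉ Ioo (0 : ℝ) 1 := by simp
  -- The velocity is `X` at all times while the frame of `Γ(·,t)` moves, so `W` and `U` are the
  -- Cramer coordinates of `X` in that frame. At `t = 0` they are `0` and `η`.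
  refine ⟨T, Γ, fun p t => bracket (X p) (v 2 p t) / bracket (v 1 p t) (v 2 p t),
    fun p t => bracket (v 1 p t) (X p) / bracket (v 1 p t) (v 2 p t), hT, ?_, ?_⟩
  · refine ⟨hreg.smooth, fun p _ => congrFun hini p, hreg.regular, ?_, ?_, ?_, ?_, ?_⟩
    · exact (ContDiffOn.bracket (hXf T) (hvs 2)).div (ContDiffOn.bracket (hvs 1) (hvs 2))
        fun x hx => hvne _ hx.1 _ hx.2
    · exact (ContDiffOn.bracket (hvs 1) (hXf T)).div (ContDiffOn.bracket (hvs 1) (hvs 2))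
        fun x hx => hvne _ hx.1 _ hx.2
    · intro p hp t ht
      rw [← eq_smul_add_smul_of_bracket_ne_zero (hvne p hp t ht) (X p)]
      exact ((((hasDerivAt_id t).smul_const (X p)).const_add (C p)).congr_deriv
        (one_smul ℝ _)).hasDerivWithinAt
    · intro t _
      simp only [(hη0 0 h00).self_of_nhds, (hη0 1 h11).self_of_nhds, (hb0 _).1, zero_div,
        and_self]
    · intro t _ i _
      refine ⟨iteratedDerivWithin_eq_zero_of_eventually ?_ i,
        iteratedDerivWithin_eq_zero_of_eventually ?_ i⟩
      · filter_upwards [hη0 0 h00] with q hq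
        rw [hq, (hb0 _).2, zero_div]
      · filter_upwards [hη0 1 h11] with q hq
        rw [hq, (hb0 _).2, zero_div]
  · intro p hp
    have hne := hC.bracket_ne_zero hp
    simp only [hv, hini, hX, bracket_smul_right]
    rw [mul_div_assoc, div_self hne, mul_one]

/-- The Euler-Lagrange equation of the fully affine length. -/
theorem isExtremal_iff_eulerLagrange {C : ℝ → Fin 2 → ℝ} (hC : IsRegularCurve C) :
    IsExtremal C ↔ ∀ p ∈ Icc (0 : ℝ) 1, eulerLagrange C p = 0 := by
  obtain ⟨e, he2, he⟩ := hC.exists_sign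
  have he' : ∀ p ∈ Icc (0 : ℝ) 1, ε C p = e := fun p hp => (he p hp).1
  constructor
  · intro hext
    have hc : ContinuousOn (fun p => g C p * eulerLagrange C p) (Icc 0 1) :=
      (hC.smooth_g.mul hC.smooth_eulerLagrange).continuousOn
    have htest : ∀ η : ℝ → ℝ, ContDiff ℝ ∞ η → HasCompactSupport η → tsupport η ⊆ Ioo 0 1 →
        ∫ p, η p • (g C p * eulerLagrange C p) = 0 := by
      intro η hη _ hsupp
      obtain ⟨T, Γ, W, U, hT, hdef, hU⟩ := hC.exists_isDeformation hη hsupp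
      have h1 := (uniqueDiffOn_Ico0 T 0 (left_mem_Ico.2 hT)).eq_deriv _
        (hdef.hasDerivWithinAt_length hC hT he') (hext T Γ W U hT hdef)
      have hen : -(e / 2) ≠ 0 := by
        intro h
        have : e = 0 := by linarith
        rw [this] at he2
        norm_num at he2
      have h2 := (mul_eq_zero.1 h1).resolve_left hen
      rw [← h2, intervalIntegral.integral_of_le zero_le_one,
        ← MeasureTheory.setIntegral_eq_integral_of_forall_compl_eq_zero (s := Ioc 0 1)]
      · refine MeasureTheory.setIntegral_congr_fun measurableSet_Ioc fun p hp => ?_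
        simp only [hU p (Ioc_subset_Icc_self hp), smul_eq_mul]
        ring
      · intro p hp
        have : η p = 0 := image_eq_zero_of_notMem_tsupport
          fun h => hp (Ioo_subset_Ioc_self (hsupp h))
        rw [this, zero_smul]
    have hae := isOpen_Ioo.ae_eq_zero_of_integral_contDiff_smul_eq_zero
      ((hc.mono Ioo_subset_Icc_self).locallyIntegrableOn measurableSet_Ioo) htest
    have hzero : EqOn (fun p => g C p * eulerLagrange C p) (fun _ => 0) (Ioo 0 1) :=
      MeasureTheory.Measure.eqOn_open_of_ae_eq
        ((MeasureTheory.ae_restrict_iff' measurableSet_Ioo).2 hae) isOpen_Ioo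
        (hc.mono Ioo_subset_Icc_self) continuousOn_const
    -- Test functions only see the open interval; continuity extends the equation to the endpoints.
    have hzero' := hzero.of_subset_closure hc continuousOn_const Ioo_subset_Icc_self
      (closure_Ioo zero_ne_one).ge
    exact fun p hp => (mul_eq_zero.1 (hzero' hp)).resolve_left (hC.g_pos hp).ne'
  · intro hEL T Γ W U hT hdef
    refine (hdef.hasDerivWithinAt_length hC hT he').congr_deriv ?_
    rw [intervalIntegral.integral_congr (g := fun _ => (0 : ℝ))]
    · simp
    · intro p hp
      rw [uIcc_of_le zero_le_one] at hp
      simp only [hEL p hp, mul_zero]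

theorem ξDerivIter_succ_const {C : ℝ → Fin 2 → ℝ} {f : ℝ → ℝ} {c : ℝ}
    (h : ∀ p ∈ Icc (0 : ℝ) 1, f p = c) (k : ℕ) :
    ∀ p ∈ Icc (0 : ℝ) 1, ξDerivIter (k + 1) C f p = 0 := by
  have base : ∀ {f : ℝ → ℝ} {c : ℝ}, (∀ p ∈ Icc (0 : ℝ) 1, f p = c) →
      ∀ p ∈ Icc (0 : ℝ) 1, ξDeriv C f p = 0 := fun h p hp => by
    rw [ξDeriv, derivWithin_congr h (h p hp), derivWithin_fun_const, Pi.zero_apply, smul_zero]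
  induction k with
  | zero => exact base h
  | succ k ih => rw [ξDerivIter_succ]; exact base ih

end FullyAffine

end

theorem mainTheorem3 (C : ℝ → Fin 2 → ℝ) (hC : FullyAffine.IsRegularCurve C) :
    (FullyAffine.IsExtremal C ↔
      ∀ p ∈ Set.Icc (0 : ℝ) 1,
        FullyAffine.ξDerivIter 3 C (FullyAffine.φ C) p
          + FullyAffine.φ C p * FullyAffine.ξDerivIter 2 C (FullyAffine.φ C) p
          + (2 * FullyAffine.φ C p ^ 2 + 3 * FullyAffine.ξDerivIter 1 C (FullyAffine.φ C) p
              + FullyAffine.ε C p) / 9 * FullyAffine.ξDerivIter 1 C (FullyAffine.φ C) p = 0) ∧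
    ((∃ c : ℝ, ∀ p ∈ Set.Icc (0 : ℝ) 1, FullyAffine.φ C p = c) →
      FullyAffine.IsExtremal C) := by
  refine ⟨FullyAffine.isExtremal_iff_eulerLagrange hC, fun ⟨c, hc⟩ =>
    (FullyAffine.isExtremal_iff_eulerLagrange hC).2 fun p hp => ?_⟩
  have h := fun k => FullyAffine.ξDerivIter_succ_const (C := C) hc k p hp
  -- Each term of the Euler–Lagrange expression carries a derivative of `φ` as a factor.
  rw [FullyAffine.eulerLagrange, h 0, h 1, h 2]
  ring
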